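/- Let $\Pi$ be a polar space of type $\mathsf{D}_n$ with $n\ge 4$, i.e. a polar space (in the sense of Buekenhout and Shult) all of whose maximal singular subspaces have dimension $n-1$ and in which every $(n-2)$-dimensional singular subspace is contained in precisely two maximal singular subspaces. Let $\Gamma_{n-1}(\Pi)$ be the dual polar graph: its vertices are the maximal singular subspaces, and two distinct ones are adjacent if their intersection is $(n-2)$-dimensional. Let $\mathcal G_+(\Pi),\mathcal G_-(\Pi)$ be the half-spin Grassmannians, i.e. the two parts of the set of maximal singular subspaces such that distances in $\Gamma_{n-1}(\Pi)$ are even within each part and odd between the parts. For $\delta\in\{+,-\}$ let $-\delta$ be the other sign, and let $\Gamma_\delta(\Pi)$ be the graph on $\mathcal G_\delta(\Pi)$ in which distinct elements are adjacent if their intersection is $(n-3)$-dimensional. A *star* of $\Gamma_\delta(\Pi)$ is the set of all elements of $\mathcal G_\delta(\Pi)$ containing a fixed $(n-4)$-dimensional singular subspace. The *special subspace* $[U]_\delta$, $U\in\mathcal G_{-\delta}(\Pi)$, is the set of all $S\in\mathcal G_\delta(\Pi)$ with $\dim(S\cap U)=n-2$. Let $m\ge 4$. Let $H_m$ be the hypercube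 graph on $\{0,1\}^m$ and let $\tfrac12H_m$ be the half-cube graph: its vertices are the vertices of $H_m$ of even weight, two of them being adjacent if they differ in exactly two coordinates. A *star* of $\tfrac12H_m$ consists of the four even vertices that have prescribed values in all coordinates outside a fixed $3$-element set of coordinates. The *special subset* of $\tfrac12H_m$ given by an odd vertex $u$ of $H_m$ consists of the $m$ vertices adjacent to $u$ in $H_m$. An *embedding* of a graph in another graph is an injective map of the vertex sets such that two vertices are adjacent if and only if their images are adjacent; it need not be isometric. Let $f$ be an embedding of $\tfrac12H_m$ in $\Gamma_\delta(\Pi)$. Then $f$ extends to an embedding of $H_m$ in $\Gamma_{n-1}(\Pi)$ if and only if it satisfies the condition (A) the image under $f$ of every star is contained in a star, and the image of every special subset is contained in a special subspace. In that case the extension $g$ is unique, and for every odd vertex $u$ of $H_m$ the subspace $g(u)$ is the unique element $U$ of $\mathcal G_{-\delta}(\Pi)$ such that $[U]_\delta$ contains the image under $f$ of the special subset given by $u$. -/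

import Mathlib

/-! ### Partial linear spaces -/

/-- A partial linear space with point set `P`: a family of proper subsets of `P`, the lines. -/
structure PartialLinearSpace (P : Type*) where
  lines : Set (Set P)
  nonempty : Nonempty P
  line_ne_univ : ∀ L ∈ lines, L ≠ Set.univ
  line_nontrivial : ∀ L ∈ lines, L.Nontrivial
  exists_line : ∀ p : P, ∃ L ∈ lines, p ∈ L
  line_unique : ∀ p q : P, p ≠ q → ∀ L ∈ lines, ∀ L' ∈ lines,
    p ∈ L → q ∈ L → p ∈ L' → q ∈ L' → L = L'

namespace PartialLinearSpace

variable {P : Type*} (Q : PartialLinearSpace P)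

/-- Two points are collinear if some line contains both (so a point is collinear with itself). -/
def Coll (p q : P) : Prop := ∃ L ∈ Q.lines, p ∈ L ∧ q ∈ L

/-- `S` is a subspace: a line through two distinct points of `S` is contained in `S`. -/
def IsSubspace (S : Set P) : Prop :=
  ∀ L ∈ Q.lines, ∀ p ∈ S, ∀ q ∈ S, p ≠ q → p ∈ L → q ∈ L → L ⊆ S

/-- A singular subspace: a subspace whose points are pairwise collinear. -/
def IsSingular (S : Set P) : Prop :=
  Q.IsSubspace S ∧ ∀ p ∈ S, ∀ q ∈ S, Q.Coll p q

/-- A singular subspace that is maximal with respect to inclusion. -/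
def IsMaxSingular (S : Set P) : Prop :=
  Q.IsSingular S ∧ ∀ T : Set P, Q.IsSingular T → S ⊆ T → S = T

/-- The subspace spanned by `X`. -/
def span (X : Set P) : Set P := ⋂₀ {S | Q.IsSubspace S ∧ X ⊆ S}

/-- `X` is independent: no proper subset of `X` spans the subspace spanned by `X`. -/
def Indep (X : Set P) : Prop := ∀ Y ⊂ X, Q.span Y ≠ Q.span X

/-- `X` is a base of `S`. -/
def IsBase (X S : Set P) : Prop := X ⊆ S ∧ Q.Indep X ∧ Q.span X = S

/-- `S` has (finite, projective) dimension `d`: the number `d` is the least one such that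
`S` has a base with `d + 1` elements.  The empty set has dimension `-1`, a point dimension `0`. -/
def HasDim (S : Set P) (d : ℤ) : Prop :=
  IsLeast {k : ℤ | ∃ X : Set P, X.Finite ∧ Q.IsBase X S ∧ (X.ncard : ℤ) = k + 1} d

/-- The Grassmannian of `k`-dimensional singular subspaces. -/
abbrev Grassmannian (k : ℤ) : Type _ := {S : Set P // Q.IsSingular S ∧ Q.HasDim S k}

end PartialLinearSpace

/-! ### Polar spaces -/

/-- A polar space, by the Buekenhout–Shult axioms. -/
structure PolarSpace (P : Type*) extends PartialLinearSpace P where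
  three_le_line : ∀ L ∈ lines, 3 ≤ L.encard
  nondegenerate : ¬ ∃ p : P, ∀ q : P, toPartialLinearSpace.Coll p q
  one_or_all : ∀ p : P, ∀ L ∈ lines,
    (∃! q, q ∈ L ∧ toPartialLinearSpace.Coll p q) ∨ ∀ q ∈ L, toPartialLinearSpace.Coll p q
  flag_finite : ∀ C : Set (Set P),
    (∀ S ∈ C, toPartialLinearSpace.IsSingular S) → IsChain (· ⊆ ·) C → C.Finite

namespace PolarSpace

variable {P : Type*} (Q : PolarSpace P)

/-- `Q` has rank `n`: all maximal singular subspaces are `(n - 1)`-dimensional. -/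
def HasRank (n : ℕ) : Prop :=
  ∀ S : Set P, Q.IsMaxSingular S → Q.HasDim S ((n : ℤ) - 1)

/-- `Q` is of type `D_n`: it has rank `n` and every `(n - 2)`-dimensional singular subspace is
contained in precisely two maximal singular subspaces. -/
def IsTypeD (n : ℕ) : Prop :=
  Q.HasRank n ∧ ∀ N : Set P, Q.IsSingular N → Q.HasDim N ((n : ℤ) - 2) →
    {S : Set P | Q.IsMaxSingular S ∧ N ⊆ S}.encard = 2

/-- The vertices of the dual polar graph: the `(n - 1)`-dimensional singular subspaces, which
are the maximal singular subspaces if `Q` has rank `n`. -/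
abbrev MaxGr (n : ℕ) : Type _ := Q.Grassmannian ((n : ℤ) - 1)

/-- The dual polar graph `Γ_{n-1}(Q)`. -/
def dualPolarGraph (n : ℕ) : SimpleGraph (Q.MaxGr n) where
  Adj S U := S ≠ U ∧ Q.HasDim (S.1 ∩ U.1) ((n : ℤ) - 2)
  symm := ⟨fun S U h => ⟨h.1.symm, by rw [Set.inter_comm]; exact h.2⟩⟩
  loopless := ⟨fun _ h => h.1 rfl⟩

variable {Q}

/-- The half-spin Grassmannians of a polar space of type `D_n`, with signs `true` for `+` and
`false` for `-`.  They are the two parts of the set of maximal singular subspaces such that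
distances in the dual polar graph are even inside each part and odd between the parts; the
reference subspace `S₀` only fixes which of the two parts carries the sign `+`. -/
def halfSpin {n : ℕ} (S₀ : Q.MaxGr n) (δ : Bool) : Set (Q.MaxGr n) :=
  {S | Even ((Q.dualPolarGraph n).dist S₀ S) ↔ δ = true}

/-- The half-spin Grassmann graph `Γ_δ(Q)`. -/
def halfSpinGraph {n : ℕ} (S₀ : Q.MaxGr n) (δ : Bool) : SimpleGraph (halfSpin S₀ δ) where
  Adj S U := S ≠ U ∧ Q.HasDim (S.1.1 ∩ U.1.1) ((n : ℤ) - 3)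
  symm := ⟨fun S U h => ⟨h.1.symm, by rw [Set.inter_comm]; exact h.2⟩⟩
  loopless := ⟨fun _ h => h.1 rfl⟩

/-- The star of `Γ_δ(Q)` given by an `(n - 4)`-dimensional singular subspace `M`: all elements
of the half-spin Grassmannian containing `M`. -/
def star {n : ℕ} (S₀ : Q.MaxGr n) (δ : Bool) (M : Q.Grassmannian ((n : ℤ) - 4)) :
    Set (halfSpin S₀ δ) :=
  {S | M.1 ⊆ S.1.1}

/-- The special subspace `[U]_δ` given by an element `U` of the opposite half-spin Grassmannian:
all elements of the half-spin Grassmannian of sign `δ` meeting `U` in an `(n - 2)`-dimensional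
subspace. -/
def special {n : ℕ} (S₀ : Q.MaxGr n) (δ : Bool) (U : halfSpin S₀ (!δ)) :
    Set (halfSpin S₀ δ) :=
  {S | Q.HasDim (S.1.1 ∩ U.1.1) ((n : ℤ) - 2)}

end PolarSpace

/-! ### Hypercube and half-cube graphs -/

/-- The `m`-dimensional hypercube graph `H_m`. -/
def hypercubeGraph (m : ℕ) : SimpleGraph (Fin m → Bool) where
  Adj v w := hammingDist v w = 1
  symm := ⟨fun v w h => by rw [hammingDist_comm]; exact h⟩
  loopless := ⟨fun v h => by simp at h⟩

/-- The number of coordinates of a vertex of the hypercube equal to `true`. -/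
def cubeWeight {m : ℕ} (v : Fin m → Bool) : ℕ := (Finset.univ.filter fun i => v i = true).card

/-- Vertices of the half-cube: the vertices of `H_m` of even weight. -/
abbrev EvenVertex (m : ℕ) : Type := {v : Fin m → Bool // Even (cubeWeight v)}

/-- The vertices of `H_m` of odd weight: the opposite half. -/
abbrev OddVertex (m : ℕ) : Type := {v : Fin m → Bool // Odd (cubeWeight v)}

/-- The half-cube graph `½H_m`: even vertices, adjacent if they are at distance two in `H_m`. -/
def halfCubeGraph (m : ℕ) : SimpleGraph (EvenVertex m) where
  Adj v w := hammingDist v.1 w.1 = 2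
  symm := ⟨fun v w h => by rw [hammingDist_comm]; exact h⟩
  loopless := ⟨fun v h => by simp at h⟩

/-- For a three-element set `T` of coordinates and a vertex `x`, the star of `½H_m` consisting of
the (four) even vertices that agree with `x` outside `T`.  In an apartment this is the set of
all elements of one half that contain the span of `m - 3` pairwise collinear frame points. -/
def cubeStar {m : ℕ} (T : Finset (Fin m)) (x : Fin m → Bool) : Set (EvenVertex m) :=
  {v | ∀ i ∉ T, v.1 i = x i}

/-- The special subset of `½H_m` given by a vertex `u` of the opposite half: the (`m`) vertices
adjacent to `u` in `H_m`. -/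
def cubeSpecial {m : ℕ} (u : OddVertex m) : Set (EvenVertex m) :=
  {v | (hypercubeGraph m).Adj v.1 u.1}

/-! ### Embeddings -/

namespace PolarSpace

variable {P : Type*} {Q : PolarSpace P} {m n : ℕ} {S₀ : Q.MaxGr n} {δ : Bool}

/-- Condition (A): images of stars are contained in stars, and images of special subsets are
contained in special subspaces. -/
def ConditionA (f : halfCubeGraph m ↪g halfSpinGraph S₀ δ) : Prop :=
  (∀ (T : Finset (Fin m)) (x : Fin m → Bool), T.card = 3 →
      ∃ M : Q.Grassmannian ((n : ℤ) - 4), f '' cubeStar T x ⊆ star S₀ δ M) ∧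
    ∀ u : OddVertex m, ∃ U : halfSpin S₀ (!δ), f '' cubeSpecial u ⊆ special S₀ δ U

/-- The embedding `g` of the hypercube graph in the dual polar graph extends `f`. -/
def IsExtension (f : halfCubeGraph m ↪g halfSpinGraph S₀ δ)
    (g : hypercubeGraph m ↪g Q.dualPolarGraph n) : Prop :=
  ∀ v : EvenVertex m, g v.1 = (f v).1

/-- `f` extends to an embedding of the hypercube graph in the dual polar graph. -/
def Extendible (f : halfCubeGraph m ↪g halfSpinGraph S₀ δ) : Prop :=
  ∃ g : hypercubeGraph m ↪g Q.dualPolarGraph n, IsExtension f g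

end PolarSpace

/-!
The proof has a geometric part, which reduces everything to counting dimensions, and a short
argument about half-cubes.

*Geometry of singular subspaces.* For a singular subspace `M` there is a singular subspace `M'` such
that no point of `M` is collinear with all of `M'` (`exists_opposite`). Then `x ↦ x^⊥ ∩ M'` turns
points and lines of `M` into a dual picture in `M'`, from which the Veblen–Young axiom follows
(`veblen`). So singular subspaces are projective spaces. Adding a point to a singular subspace
raises the rank `rk` (dimension plus one) by one (`rk_span_insert`), and
`rk A + rk B ≤ rk M + rk (A ∩ B)` for `A, B ⊆ M` (`rk_add_rk_le`).

*Type `D_n`.* Passing from a maximal singular subspace to an adjacent one changes the dimension of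
the intersection with a fixed one by exactly one (`IsTypeD.rk_inter_of_adj`). As the dual polar
graph is connected, it is bipartite with the half-spin Grassmannians as parts, and codimensions of
intersections have the parity of the distance. Hence special subspaces are cliques of the half-spin
graph (`IsTypeD.eq_or_adj_of_adj`). A vertex of the half-spin graph adjacent to two points of a line
is adjacent or equal to every point of it (`IsTypeD.eq_or_adj_of_line`).

*Uniqueness.* If the image of a special subset lay in `[U]` and in `[V]` with `U ≠ V`, all its
elements would contain `U ∩ V`, hence lie on a line of the half-spin graph. For `m ≥ 4` the vertex
`u + e₁ + e₂ + e₃` is adjacent to `u + e₁` and `u + e₂` but not to `u + e₄`, which contradicts the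
property of lines (`IsTypeD.special_unique`).

*Existence.* If `[U]` contains the image of the special subset given by `u`, it contains the image
of no other vertex, because `[U]` is a clique while every other vertex is at distance at least four
from some neighbour of `u` (`IsTypeD.mem_special_iff`). So `u ↦ U` extends `f`
(`IsTypeD.exists_extension`). Only the part of the condition about special subsets is used.

*Stars.* Conversely, if `g` extends `f` and `v` is an even vertex, then
`g (v) ∩ g (v + eₐ + e_b) = g (v) ∩ g (v + eₐ) ∩ g (v + e_b)`. So the intersection of `g (v)` with
the images of its neighbours in three directions, which has codimension at most three, lies in the
images of the four vertices of the star (`IsTypeD.exists_star`).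
-/

/-! ### Spans and perps -/

namespace PartialLinearSpace

variable {P : Type*} (Q : PartialLinearSpace P)

theorem coll_refl (p : P) : Q.Coll p p := by
  obtain ⟨L, hL, hp⟩ := Q.exists_line p
  exact ⟨L, hL, hp, hp⟩

variable {Q}

theorem Coll.symm {p q : P} (h : Q.Coll p q) : Q.Coll q p := by
  obtain ⟨L, hL, hp, hq⟩ := h
  exact ⟨L, hL, hq, hp⟩

theorem IsSubspace.inter {S T : Set P} (hS : Q.IsSubspace S) (hT : Q.IsSubspace T) :
    Q.IsSubspace (S ∩ T) := fun L hL p hp q hq hpq hpL hqL =>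
  Set.subset_inter (hS L hL p hp.1 q hq.1 hpq hpL hqL) (hT L hL p hp.2 q hq.2 hpq hpL hqL)

variable (Q) in
theorem isSubspace_empty : Q.IsSubspace ∅ := fun _ _ _ hp => hp.elim

theorem subset_span (X : Set P) : X ⊆ Q.span X := fun _ hx _ hS => hS.2 hx

theorem span_subset {X S : Set P} (hS : Q.IsSubspace S) (h : X ⊆ S) : Q.span X ⊆ S :=
  fun _ hx => hx S ⟨hS, h⟩

theorem isSubspace_span (X : Set P) : Q.IsSubspace (Q.span X) :=
  fun L hL p hp q hq hpq hpL hqL _ hx S hS =>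
    hS.1 L hL p (hp S hS) q (hq S hS) hpq hpL hqL hx

theorem span_mono {X Y : Set P} (h : X ⊆ Y) : Q.span X ⊆ Q.span Y :=
  span_subset (isSubspace_span Y) (h.trans (subset_span Y))

theorem IsSubspace.span_eq {S : Set P} (hS : Q.IsSubspace S) : Q.span S = S :=
  (span_subset hS subset_rfl).antisymm (subset_span S)

theorem span_insert_span (x : P) (X : Set P) :
    Q.span (insert x (Q.span X)) = Q.span (insert x X) := by
  apply Set.Subset.antisymm
  · refine span_subset (isSubspace_span _) (Set.insert_subset ?_ ?_)
    · exact subset_span _ (Set.mem_insert _ _)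
    · exact span_mono (Set.subset_insert _ _)
  · exact span_mono (Set.insert_subset_insert (subset_span X))

theorem mem_span_insert (x : P) (X : Set P) : x ∈ Q.span (insert x X) :=
  subset_span _ (Set.mem_insert _ _)

theorem subset_span_insert (x : P) (X : Set P) : X ⊆ Q.span (insert x X) :=
  (Set.subset_insert _ _).trans (subset_span _)

theorem IsSingular.mono {S T : Set P} (hS : Q.IsSingular S) (hT : Q.IsSubspace T)
    (h : T ⊆ S) : Q.IsSingular T :=
  ⟨hT, fun p hp q hq => hS.2 p (h hp) q (h hq)⟩

theorem IsSingular.inter {S T : Set P} (hS : Q.IsSingular S) (hT : Q.IsSubspace T) :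
    Q.IsSingular (S ∩ T) :=
  hS.mono (hS.1.inter hT) Set.inter_subset_left

variable (Q) in
theorem isSingular_empty : Q.IsSingular ∅ := ⟨Q.isSubspace_empty, fun _ hp => hp.elim⟩

variable (Q) in
/-- The set `X^⊥` of all points collinear with every point of `X`. -/
def perp (X : Set P) : Set P := {y | ∀ x ∈ X, Q.Coll x y}

theorem mem_perp_singleton {x y : P} : y ∈ Q.perp {x} ↔ Q.Coll x y := by
  simp [perp]

/-- A set meeting all lines of a singular subspace `M` spans `M` together with any further point
of `M`, because the lines through that point cover `M`. -/
theorem IsSingular.subset_of_forall_line {M H T : Set P} (hM : Q.IsSingular M)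
    (hT : Q.IsSubspace T) {z : P} (hz : z ∈ M) (hzH : z ∉ H) (hzT : z ∈ T)
    (hH : ∀ L ∈ Q.lines, L ⊆ M → ∃ h ∈ L, h ∈ H) (hHT : M ∩ H ⊆ T) : M ⊆ T := by
  intro w hw
  by_cases hzw : z = w
  · exact hzw ▸ hzT
  obtain ⟨L, hL, hzL, hwL⟩ := hM.2 z hz w hw
  have hLM := hM.1 L hL z hz w hw hzw hzL hwL
  obtain ⟨h, hhL, hh⟩ := hH L hL hLM
  exact hT L hL z hzT h (hHT ⟨hLM hhL, hh⟩) (fun e => hzH (e ▸ hh)) hzL hhL hwL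

end PartialLinearSpace

namespace PolarSpace

open PartialLinearSpace

variable {P : Type*} {Q : PolarSpace P}

theorem exists_coll_mem_line (p : P) {L : Set P} (hL : L ∈ Q.lines) : ∃ q ∈ L, Q.Coll p q := by
  rcases Q.one_or_all p L hL with ⟨q, hq, -⟩ | h
  · exact ⟨q, hq⟩
  · obtain ⟨q, hq⟩ := (Q.line_nontrivial L hL).nonempty
    exact ⟨q, hq, h q hq⟩

variable (Q) in
theorem isSubspace_perp (X : Set P) : Q.IsSubspace (Q.perp X) := by
  intro L hL p hp q hq hpq hpL hqL y hy x hx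
  rcases Q.one_or_all x L hL with ⟨r, -, hr⟩ | h
  · exact absurd ((hr p ⟨hpL, hp x hx⟩).trans (hr q ⟨hqL, hq x hx⟩).symm) hpq
  · exact h y hy

theorem coll_of_mem_line {x a b y : P} {L : Set P} (hL : L ∈ Q.lines) (ha : a ∈ L) (hb : b ∈ L)
    (hab : a ≠ b) (hy : y ∈ L) (hxa : Q.Coll x a) (hxb : Q.Coll x b) : Q.Coll x y :=
  mem_perp_singleton.1 (Q.isSubspace_perp {x} L hL a (mem_perp_singleton.2 hxa) b
    (mem_perp_singleton.2 hxb) hab ha hb hy)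

theorem isSingular_span {X : Set P} (h : X ⊆ Q.perp X) : Q.IsSingular (Q.span X) := by
  have h1 : Q.span X ⊆ Q.perp X := span_subset (Q.isSubspace_perp X) h
  have h2 : X ⊆ Q.perp (Q.span X) := fun x hx y hy => (h1 hy x hx).symm
  have h3 := span_subset (Q.isSubspace_perp _) h2
  exact ⟨isSubspace_span X, fun p hp q hq => h3 hq p hp⟩

theorem isSingular_span_union {A B : Set P} (hA : Q.IsSingular A) (hB : Q.IsSingular B)
    (h : B ⊆ Q.perp A) : Q.IsSingular (Q.span (A ∪ B)) := by
  apply isSingular_span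
  rintro x (hx | hx) y (hy | hy)
  · exact hA.2 y hy x hx
  · exact (h hy x hx).symm
  · exact h hx y hy
  · exact hB.2 y hy x hx

theorem isSingular_span_insert {A : Set P} {x : P} (hA : Q.IsSingular A) (h : x ∈ Q.perp A) :
    Q.IsSingular (Q.span (insert x A)) := by
  apply isSingular_span
  rintro y (rfl | hy) z (rfl | hz)
  · exact Q.coll_refl _
  · exact h z hz
  · exact (h y hy).symm
  · exact hA.2 z hz y hy

/-- If `z ∈ M` is not collinear with `y`, then `M` is spanned by `z` and `y^⊥ ∩ M`. -/
theorem subset_of_perp_subset {M T : Set P} (hM : Q.IsSingular M) (hT : Q.IsSubspace T) {y z : P}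
    (hz : z ∈ M) (hyz : ¬ Q.Coll y z) (hzT : z ∈ T)
    (hHT : ∀ w ∈ M, Q.Coll y w → w ∈ T) : M ⊆ T :=
  hM.subset_of_forall_line hT (H := {w | Q.Coll y w}) hz hyz hzT
    (fun _ hL _ => exists_coll_mem_line y hL) (fun w hw => hHT w hw.1 hw.2)

/-! ### Finite chains -/

variable (Q) in
theorem wellFounded_gt : WellFounded fun S T : {S : Set P // Q.IsSingular S} => T.1 ⊂ S.1 := by
  have : IsStrictOrder {S : Set P // Q.IsSingular S} fun S T => T.1 ⊂ S.1 :=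
    { irrefl := fun S h => h.ne rfl
      trans := fun _ _ _ h h' => h'.trans h }
  rw [RelEmbedding.wellFounded_iff_isEmpty]
  refine ⟨fun e => ?_⟩
  have hs : StrictMono fun k => (e k).1 := strictMono_nat_of_lt_succ fun k =>
    e.map_rel_iff.2 (Nat.lt_succ_self k)
  refine Set.infinite_range_of_injective hs.injective (Q.flag_finite _ ?_ hs.monotone.isChain_range)
  rintro _ ⟨k, rfl⟩
  exact (e k).2

variable (Q) in
theorem wellFounded_lt : WellFounded fun S T : {S : Set P // Q.IsSingular S} => S.1 ⊂ T.1 := by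
  have : IsStrictOrder {S : Set P // Q.IsSingular S} fun S T => S.1 ⊂ T.1 :=
    { irrefl := fun S h => h.ne rfl
      trans := fun _ _ _ h h' => h.trans h' }
  rw [RelEmbedding.wellFounded_iff_isEmpty]
  refine ⟨fun e => ?_⟩
  have hs : StrictAnti fun k => (e k).1 := strictAnti_nat_of_succ_lt fun k =>
    e.map_rel_iff.2 (Nat.lt_succ_self k)
  refine Set.infinite_range_of_injective hs.injective (Q.flag_finite _ ?_ ?_)
  · rintro _ ⟨k, rfl⟩
    exact (e k).2
  · rintro _ ⟨k, rfl⟩ _ ⟨l, rfl⟩ -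
    exact (le_total k l).symm.imp (fun h => hs.antitone h) (fun h => hs.antitone h)

/-- Upward induction inside a singular subspace `B`: a property of subspaces of `B` that holds
for `B` and descends from `⟨x, A⟩` to `A` holds for all of them. -/
theorem induction_up {B : Set P} (hB : Q.IsSingular B) {p : Set P → Prop} (top : p B)
    (step : ∀ A x, Q.IsSingular A → A ⊆ B → x ∈ B → x ∉ A → Q.IsSingular (Q.span (insert x A)) →
      Q.span (insert x A) ⊆ B → p (Q.span (insert x A)) → p A)
    {A : Set P} (hA : Q.IsSubspace A) (hAB : A ⊆ B) : p A := by
  have key : ∀ S : {S : Set P // Q.IsSingular S}, S.1 ⊆ B → p S.1 := by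
    intro S
    refine (wellFounded_gt Q).induction (C := fun S => S.1 ⊆ B → p S.1) S ?_
    intro S ih hSB
    by_cases h : B ⊆ S.1
    · rw [hSB.antisymm h]
      exact top
    obtain ⟨x, hxB, hxS⟩ := Set.not_subset.1 h
    have hsub : Q.span (insert x S.1) ⊆ B := span_subset hB.1 (Set.insert_subset hxB hSB)
    have hsing := hB.mono (isSubspace_span _) hsub
    refine step S.1 x S.2 hSB hxB hxS hsing hsub (ih ⟨_, hsing⟩ ?_ hsub)
    exact ⟨subset_span_insert x _, fun h => hxS (h (mem_span_insert x _))⟩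
  exact key ⟨A, hB.mono hA hAB⟩ hAB

theorem exists_isMaxSingular {S : Set P} (hS : Q.IsSingular S) :
    ∃ M, Q.IsMaxSingular M ∧ S ⊆ M := by
  let F : Set {T : Set P // Q.IsSingular T} := {T | S ⊆ T.1}
  obtain ⟨M, hM, hmin⟩ := (wellFounded_gt Q).has_min F ⟨⟨S, hS⟩, Set.Subset.refl S⟩
  refine ⟨M.1, ⟨M.2, fun T hT hMT => ?_⟩, hM⟩
  by_contra hne
  exact hmin ⟨T, hT⟩ (Set.Subset.trans hM hMT) (hMT.ssubset_of_ne hne)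

/-! ### Singular subspaces are projective spaces -/

/-- For every singular subspace `M` there is a singular subspace `M'` such that no point of `M`
is collinear with all points of `M'`. -/
theorem exists_opposite {M : Set P} (hM : Q.IsSingular M) :
    ∃ M', Q.IsSingular M' ∧ ∀ x ∈ M, ∃ y ∈ M', ¬ Q.Coll x y := by
  let F : Set {T : Set P // Q.IsSingular T} :=
    {T | ∃ M', Q.IsSingular M' ∧ T.1 = M ∩ Q.perp M'}
  obtain ⟨T, ⟨M', hM', hT⟩, hmin⟩ := (wellFounded_lt Q).has_min F
    ⟨⟨_, hM.inter (Q.isSubspace_perp ∅)⟩, ∅, Q.isSingular_empty, rfl⟩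
  refine ⟨M', hM', ?_⟩
  by_contra! hcon
  obtain ⟨x, hxM, hx⟩ := hcon
  have hxp : x ∈ Q.perp M' := fun y hy => (hx y hy).symm
  obtain ⟨y, hxy⟩ := not_forall.1 (not_exists.1 Q.nondegenerate x)
  -- Replace `M'` by the span of `y` and the part of `⟨x, M'⟩` collinear with `y`.
  set N := Q.span (insert x M')
  have hN : Q.IsSingular N := isSingular_span_insert hM' hxp
  have hH : Q.IsSingular (N ∩ Q.perp {y}) := hN.inter (Q.isSubspace_perp _)
  have hy : y ∈ Q.perp (N ∩ Q.perp {y}) := fun z hz => (mem_perp_singleton.1 hz.2).symm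
  refine hmin ⟨_, hM.inter (Q.isSubspace_perp (Q.span (insert y (N ∩ Q.perp {y}))))⟩
    ⟨_, isSingular_span_insert hH hy, rfl⟩ ?_
  rw [hT]
  refine ⟨fun w hw => ⟨hw.1, ?_⟩, fun h => ?_⟩
  · have h1 : N ⊆ Q.perp {w} := by
      refine subset_of_perp_subset hN (Q.isSubspace_perp _) (y := y) (mem_span_insert x _)
        (fun h => hxy h.symm) (mem_perp_singleton.2 (hM.2 w hw.1 x hxM)) fun v hv hyv => ?_
      exact mem_perp_singleton.2
        (hw.2 v (subset_span_insert y _ ⟨hv, mem_perp_singleton.2 hyv⟩)).symm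
    exact fun v hv => (mem_perp_singleton.1 (h1 (subset_span_insert x _ hv))).symm
  · exact hxy ((h ⟨hxM, hxp⟩).2 y (mem_span_insert y _)).symm

/-- `x ↦ x^⊥ ∩ M'` is injective on `M` if no point of `M` is collinear with all points of `M'`. -/
theorem eq_of_perp_subset {M M' : Set P} (hM : Q.IsSingular M) (hM' : Q.IsSingular M')
    (hopp : ∀ x ∈ M, ∃ y ∈ M', ¬ Q.Coll x y) {x w : P} (hx : x ∈ M) (hw : w ∈ M)
    (h : ∀ y ∈ M', Q.Coll x y → Q.Coll w y) : x = w := by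
  by_contra hne
  obtain ⟨L, hL, hxL, hwL⟩ := hM.2 x hx w hw
  obtain ⟨y, hy, hwy⟩ := hopp w hw
  obtain ⟨v, hvL, hyv⟩ := exists_coll_mem_line y hL
  obtain ⟨z, hz, hvz⟩ := hopp v (hM.1 L hL x hx w hw hne hxL hwL hvL)
  refine hvz (mem_perp_singleton.1 (subset_of_perp_subset hM' (Q.isSubspace_perp {v}) (y := x) hy
    (fun hxy => hwy (h y hy hxy)) (mem_perp_singleton.2 hyv.symm) (fun t ht hxt => ?_) hz))
  exact mem_perp_singleton.2
    (coll_of_mem_line hL hxL hwL hne hvL hxt.symm (h t ht hxt).symm).symm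

/-- Each line `L` of `M` is recovered from `L^⊥ ∩ M'`. -/
theorem mem_line_of_perp {M M' : Set P} (hM : Q.IsSingular M) (hM' : Q.IsSingular M')
    (hopp : ∀ x ∈ M, ∃ y ∈ M', ¬ Q.Coll x y) {L : Set P} (hL : L ∈ Q.lines) {a b c : P}
    (ha : a ∈ M) (hb : b ∈ M) (hc : c ∈ M) (haL : a ∈ L) (hbL : b ∈ L) (hab : a ≠ b)
    (h : ∀ y ∈ M', Q.Coll a y → Q.Coll b y → Q.Coll c y) : c ∈ L := by
  have hLM := hM.1 L hL a ha b hb hab haL hbL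
  by_cases hcase : ∀ y ∈ M', Q.Coll c y → Q.Coll a y
  · exact eq_of_perp_subset hM hM' hopp hc ha hcase ▸ haL
  push Not at hcase
  obtain ⟨y, hy, hcy, hay⟩ := hcase
  obtain ⟨d, hdL, hyd⟩ := exists_coll_mem_line y hL
  have hda : d ≠ a := by
    rintro rfl
    exact hay hyd.symm
  suffices d = c from this ▸ hdL
  refine eq_of_perp_subset hM hM' hopp (hLM hdL) hc fun w hw hdw => ?_
  refine mem_perp_singleton.1 (subset_of_perp_subset (hM'.inter (Q.isSubspace_perp {d}))
    (Q.isSubspace_perp {c}) (y := a) (z := y) ⟨hy, mem_perp_singleton.2 hyd.symm⟩ hay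
    (mem_perp_singleton.2 hcy) (fun t ht hat => ?_) ⟨hw, mem_perp_singleton.2 hdw⟩)
  exact mem_perp_singleton.2 (h t ht.1 hat
    (coll_of_mem_line hL hdL haL hda hbL (mem_perp_singleton.1 ht.2).symm hat.symm).symm)

/-- The Veblen–Young axiom: in a singular subspace, a line `L'` that meets two sides of a triangle
in points other than their common vertex `p` meets the third side `L`. -/
theorem veblen {M : Set P} (hM : Q.IsSingular M) {L₁ L₂ L L' : Set P} (hL₁ : L₁ ∈ Q.lines)
    (hL₂ : L₂ ∈ Q.lines) (hL : L ∈ Q.lines) (hL' : L' ∈ Q.lines) {p a b a' b' : P} (hp : p ∈ M)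
    (ha : a ∈ M) (hb : b ∈ M) (ha' : a' ∈ M) (hb' : b' ∈ M) (hp₁ : p ∈ L₁) (ha₁ : a ∈ L₁)
    (ha'₁ : a' ∈ L₁) (hp₂ : p ∈ L₂) (hb₂ : b ∈ L₂) (hb'₂ : b' ∈ L₂) (haL : a ∈ L) (hbL : b ∈ L)
    (ha'L : a' ∈ L') (hb'L : b' ∈ L') (hab : a ≠ b) (hab' : a' ≠ b') (hpL' : p ∉ L') :
    ∃ c ∈ L, c ∈ L' := by
  obtain ⟨M', hM', hopp⟩ := exists_opposite hM
  have hpa : p ≠ a' := fun h => hpL' (h ▸ ha'L)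
  have hpb : p ≠ b' := fun h => hpL' (h ▸ hb'L)
  obtain ⟨z, hz, haz, hbz, hpz⟩ :
      ∃ z ∈ M', Q.Coll a' z ∧ Q.Coll b' z ∧ ¬ Q.Coll p z := by
    by_contra! hcon
    exact hpL' (mem_line_of_perp hM hM' hopp hL' ha' hb' hp ha'L hb'L hab' hcon)
  obtain ⟨c, hcL, hzc⟩ := exists_coll_mem_line z hL
  refine ⟨c, hcL, mem_line_of_perp hM hM' hopp hL' ha' hb'
    (hM.1 L hL a ha b hb hab haL hbL hcL) ha'L hb'L hab' fun y hy hay hby => ?_⟩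
  refine mem_perp_singleton.1 (subset_of_perp_subset
    (hM'.inter ((Q.isSubspace_perp {a'}).inter (Q.isSubspace_perp {b'})))
    (Q.isSubspace_perp {c}) (y := p) (z := z)
    ⟨hz, mem_perp_singleton.2 haz, mem_perp_singleton.2 hbz⟩ hpz
    (mem_perp_singleton.2 hzc.symm) (fun t ht hpt => ?_)
    ⟨hy, mem_perp_singleton.2 hay, mem_perp_singleton.2 hby⟩)
  have hta := coll_of_mem_line hL₁ hp₁ ha'₁ hpa ha₁ hpt.symm (mem_perp_singleton.1 ht.2.1).symm
  have htb := coll_of_mem_line hL₂ hp₂ hb'₂ hpb hb₂ hpt.symm (mem_perp_singleton.1 ht.2.2).symm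
  exact mem_perp_singleton.2 (coll_of_mem_line hL haL hbL hab hcL hta htb).symm

variable (Q) in
/-- The union of the point `x` and the lines joining `x` to points of `A`. -/
def cone (x : P) (A : Set P) : Set P :=
  {y | y = x ∨ ∃ a ∈ A, ∃ L ∈ Q.lines, x ∈ L ∧ a ∈ L ∧ y ∈ L}

/-- A line containing two points of the cone over `A` meets `A`. -/
theorem exists_mem_of_mem_cone {A : Set P} {x : P} (hA : Q.IsSubspace A)
    (hM : Q.IsSingular (Q.span (insert x A)))
    (hx : x ∉ A) {y y' : P} (hy : y ∈ Q.cone x A)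
    (hy' : y' ∈ Q.cone x A) (hne : y ≠ y') {N : Set P} (hN : N ∈ Q.lines) (hyN : y ∈ N)
    (hy'N : y' ∈ N) : ∃ e ∈ N, e ∈ A := by
  have key : ∀ z ∈ Q.cone x A, z ∈ N → z ≠ x → x ∈ N → ∃ e ∈ N, e ∈ A := by
    rintro z (rfl | ⟨a, ha, L, hL, hxL, haL, hzL⟩) hzN hzx hxN
    · exact absurd rfl hzx
    · rw [Q.line_unique z x hzx N hN L hL hzN hxN hzL hxL]
      exact ⟨a, haL, ha⟩
  by_cases hxN : x ∈ N
  · by_cases hyx : y = x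
    · exact key y' hy' hy'N (fun h => hne (hyx.trans h.symm)) hxN
    · exact key y hy hyN hyx hxN
  rcases hy with rfl | ⟨a, ha, L, hL, hxL, haL, hyL⟩
  · exact absurd hyN hxN
  rcases hy' with rfl | ⟨a', ha', L', hL', hxL', ha'L', hy'L'⟩
  · exact absurd hy'N hxN
  have hxM := mem_span_insert (Q := Q.toPartialLinearSpace) x A
  have hAM := subset_span_insert (Q := Q.toPartialLinearSpace) x A
  have hxa : x ≠ a := fun h => hx (h ▸ ha)
  have hxa' : x ≠ a' := fun h => hx (h ▸ ha')
  have haa' : a ≠ a' := by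
    rintro rfl
    have h := Q.line_unique x a hxa L hL L' hL' hxL haL hxL' ha'L'
    rw [← h] at hy'L'
    exact hxN (Q.line_unique y y' hne N hN L hL hyN hy'N hyL hy'L' ▸ hxL)
  obtain ⟨K, hK, haK, ha'K⟩ := hM.2 a (hAM ha) a' (hAM ha')
  have hyM := hM.1 L hL x hxM a (hAM ha) hxa hxL haL hyL
  have hyM' := hM.1 L' hL' x hxM a' (hAM ha') hxa' hxL' ha'L' hy'L'
  obtain ⟨e, heK, heN⟩ := veblen hM hL hL' hK hN hxM (hAM ha) (hAM ha') hyM hyM' hxL haL hyL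
    hxL' ha'L' hy'L' haK ha'K hyN hy'N haa' hne hxN
  exact ⟨e, heN, hA K hK a ha a' ha' haa' haK ha'K heK⟩

theorem isSubspace_cone {A : Set P} {x : P} (hA : Q.IsSubspace A)
    (hM : Q.IsSingular (Q.span (insert x A))) (hx : x ∉ A) : Q.IsSubspace (Q.cone x A) := by
  have hxM := mem_span_insert (Q := Q.toPartialLinearSpace) x A
  have hAM := subset_span_insert (Q := Q.toPartialLinearSpace) x A
  have hsub : A ⊆ Q.cone x A := by
    intro a ha
    obtain ⟨L, hL, hxL, haL⟩ := hM.2 x hxM a (hAM ha)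
    exact Or.inr ⟨a, ha, L, hL, hxL, haL, haL⟩
  intro N hN y hy y' hy' hne hyN hy'N w hwN
  obtain ⟨e, heN, he⟩ := exists_mem_of_mem_cone hA hM hx hy hy' hne hN hyN hy'N
  by_cases hxN : x ∈ N
  · exact Or.inr ⟨e, he, N, hN, hxN, heN, hwN⟩
  obtain ⟨z, hz, hzN, hze⟩ : ∃ z ∈ Q.cone x A, z ∈ N ∧ z ≠ e := by
    by_cases h : y = e
    · exact ⟨y', hy', hy'N, fun h' => hne (h.trans h'.symm)⟩
    · exact ⟨y, hy, hyN, h⟩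
  by_cases hwz : w = z
  · exact hwz ▸ hz
  rcases hz with rfl | ⟨a, ha, L, hL, hxL, haL, hzL⟩
  · exact absurd hzN hxN
  have hxa : x ≠ a := fun h => hx (h ▸ ha)
  have hea : e ≠ a := by
    rintro rfl
    exact hxN (Q.line_unique z e hze N hN L hL hzN heN hzL haL ▸ hxL)
  have hwx : w ≠ x := fun h => hxN (h ▸ hwN)
  have hzM := hM.1 L hL x hxM a (hAM ha) hxa hxL haL hzL
  have hwM := hM.1 N hN z hzM e (hAM he) hze hzN heN hwN
  obtain ⟨K, hK, heK, haK⟩ := hM.2 e (hAM he) a (hAM ha)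
  obtain ⟨J, hJ, hwJ, hxJ⟩ := hM.2 w hwM x hxM
  have hzJ : z ∉ J := fun h =>
    hxN (Q.line_unique w z hwz N hN J hJ hwN hzN hwJ h ▸ hxJ)
  obtain ⟨c, hcK, hcJ⟩ := veblen hM hN hL hK hJ hzM (hAM he) (hAM ha) hwM hxM hzN heN hwN
    hzL haL hxL heK haK hwJ hxJ hea hwx hzJ
  exact Or.inr ⟨c, hA K hK e he a ha hea heK haK hcK, J, hJ, hxJ, hcJ, hwJ⟩

theorem span_insert_subset_cone {A : Set P} {x : P} (hA : Q.IsSubspace A)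
    (hM : Q.IsSingular (Q.span (insert x A))) (hx : x ∉ A) :
    Q.span (insert x A) ⊆ Q.cone x A := by
  refine span_subset (isSubspace_cone hA hM hx) (Set.insert_subset (Or.inl rfl) fun a ha => ?_)
  obtain ⟨L, hL, hxL, haL⟩ := hM.2 x (mem_span_insert x A) a (subset_span_insert x A ha)
  exact Or.inr ⟨a, ha, L, hL, hxL, haL, haL⟩

/-- `A` is a hyperplane of `⟨x, A⟩`: it meets every line of that singular subspace. -/
theorem exists_mem_of_line_subset {A : Set P} {x : P} (hA : Q.IsSubspace A)
    (hM : Q.IsSingular (Q.span (insert x A))) (hx : x ∉ A) {N : Set P} (hN : N ∈ Q.lines)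
    (hNM : N ⊆ Q.span (insert x A)) : ∃ e ∈ N, e ∈ A := by
  obtain ⟨y, hy, y', hy', hne⟩ := Q.line_nontrivial N hN
  exact exists_mem_of_mem_cone hA hM hx (span_insert_subset_cone hA hM hx (hNM hy))
    (span_insert_subset_cone hA hM hx (hNM hy')) hne hN hy hy'

/-! ### Rank of singular subspaces -/

variable (Q) in
/-- The least number of points spanning `S`; for a singular subspace this is its projective
dimension plus one. -/
noncomputable def rk (S : Set P) : ℕ :=
  sInf {k | ∃ X : Finset P, X.card = k ∧ Q.span (X : Set P) = S}

theorem rk_le {S : Set P} {X : Finset P} (h : Q.span (X : Set P) = S) : Q.rk S ≤ X.card :=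
  Nat.sInf_le ⟨X, rfl, h⟩

theorem exists_span_eq {S : Set P} (hS : Q.IsSingular S) :
    ∃ X : Finset P, X.card = Q.rk S ∧ Q.span (X : Set P) = S := by
  classical
  have hne : ∃ X : Finset P, Q.span (X : Set P) = S := by
    -- A finite subset of `S` whose span is as large as possible spans `S`.
    obtain ⟨T, ⟨X, hXS, hXT⟩, hmax⟩ := (wellFounded_gt Q).has_min
      {T | ∃ X : Finset P, (X : Set P) ⊆ S ∧ Q.span (X : Set P) = T.1}
      ⟨⟨_, hS.mono (isSubspace_span ((∅ : Finset P) : Set P))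
        (span_subset hS.1 (by simp))⟩, ∅, by simp, rfl⟩
    refine ⟨X, (span_subset hS.1 hXS).antisymm fun x hx => ?_⟩
    by_contra hxX
    have hsub : ((insert x X : Finset P) : Set P) ⊆ S := by
      rw [Finset.coe_insert]
      exact Set.insert_subset hx hXS
    refine hmax ⟨_, hS.mono (isSubspace_span _) (span_subset hS.1 hsub)⟩
      ⟨insert x X, hsub, rfl⟩ ?_
    rw [← hXT]
    refine ⟨span_mono (by simp), fun h => hxX (h (subset_span _ (by simp)))⟩
  obtain ⟨X, hX⟩ := hne
  exact Nat.sInf_mem (s := {k | ∃ X : Finset P, X.card = k ∧ Q.span (X : Set P) = S})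
    ⟨X.card, X, rfl, hX⟩

variable (Q) in
theorem rk_empty : Q.rk ∅ = 0 :=
  Nat.le_zero.1 (rk_le (X := ∅) (by simpa using Q.isSubspace_empty.span_eq))

theorem rk_span_insert {A : Set P} {x : P} (hA : Q.IsSingular A)
    (hM : Q.IsSingular (Q.span (insert x A))) (hx : x ∉ A) :
    Q.rk (Q.span (insert x A)) = Q.rk A + 1 := by
  classical
  apply le_antisymm
  · obtain ⟨X, hXc, hX⟩ := exists_span_eq hA
    have h : Q.span ((insert x X : Finset P) : Set P) = Q.span (insert x A) := by
      rw [Finset.coe_insert, ← span_insert_span, hX]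
    exact (rk_le h).trans ((Finset.card_insert_le _ _).trans (by omega))
  · obtain ⟨Z, hZc, hZ⟩ := exists_span_eq hM
    obtain ⟨z, hz, hzA⟩ : ∃ z ∈ Z, z ∉ A := by
      by_contra! h
      exact hx (span_subset hA.1 (fun z hz => h z hz) (hZ ▸ mem_span_insert x A))
    have hZM : ∀ y ∈ Z, y ∈ Q.span (insert x A) := fun y hy => hZ ▸ subset_span _ hy
    -- Project the other generators from `z` to `A`.
    have hproj : ∀ y ∈ Z.erase z, ∃ e ∈ A, ∃ L ∈ Q.lines, z ∈ L ∧ y ∈ L ∧ e ∈ L := by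
      intro y hy
      obtain ⟨hyz, hyZ⟩ := Finset.mem_erase.1 hy
      obtain ⟨L, hL, hzL, hyL⟩ := hM.2 z (hZM z hz) y (hZM y hyZ)
      obtain ⟨e, heL, he⟩ := exists_mem_of_line_subset hA.1 hM hx hL
        (hM.1 L hL z (hZM z hz) y (hZM y hyZ) hyz.symm hzL hyL)
      exact ⟨e, he, L, hL, hzL, hyL, heL⟩
    choose! e heA L hL hzL hyL heL using hproj
    set X := (Z.erase z).image e
    have hXA : Q.span (X : Set P) ⊆ A := by
      refine span_subset hA.1 fun w hw => ?_
      obtain ⟨y, hy, rfl⟩ := Finset.mem_image.1 (Finset.mem_coe.1 hw)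
      exact heA y hy
    have hzX : Q.span (insert z (Q.span (X : Set P))) = Q.span (insert x A) := by
      apply Set.Subset.antisymm
      · refine span_subset hM.1 (Set.insert_subset (hZM z hz) ?_)
        exact hXA.trans (subset_span_insert x A)
      · rw [← hZ]
        refine span_subset (isSubspace_span _) fun y hy => ?_
        by_cases hyz : y = z
        · rw [hyz]
          exact mem_span_insert z _
        have hy' : y ∈ Z.erase z := Finset.mem_erase.2 ⟨hyz, hy⟩
        have heX : e y ∈ Q.span (X : Set P) :=
          subset_span _ (Finset.mem_coe.2 (Finset.mem_image_of_mem e hy'))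
        exact isSubspace_span _ (L y) (hL y hy') z (mem_span_insert z _) (e y)
          (subset_span_insert z _ heX) (fun h => hzA (h ▸ heA y hy')) (hzL y hy') (heL y hy')
          (hyL y hy')
    have hAX : A ⊆ Q.span (X : Set P) := by
      intro a ha
      have h1 : a ∈ Q.cone z (Q.span (X : Set P)) := by
        refine span_insert_subset_cone (isSubspace_span _) (hzX ▸ hM) (fun h => hzA (hXA h)) ?_
        rw [hzX]
        exact subset_span_insert x A ha
      rcases h1 with rfl | ⟨b, hb, K, hK, hzK, hbK, haK⟩
      · exact absurd ha hzA
      by_cases hab : a = b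
      · exact hab ▸ hb
      · exact absurd (hA.1 K hK a ha b (hXA hb) hab haK hbK hzK) hzA
    have h1 : Q.rk A ≤ X.card := rk_le (hXA.antisymm hAX)
    have h2 : X.card ≤ (Z.erase z).card := Finset.card_image_le
    have h3 := Finset.card_erase_add_one hz
    omega

theorem rk_mono {A B : Set P} (hA : Q.IsSubspace A) (hB : Q.IsSingular B) (h : A ⊆ B) :
    Q.rk A ≤ Q.rk B := by
  refine induction_up hB (p := fun A => Q.rk A ≤ Q.rk B) le_rfl ?_ hA h
  intro A x hA _ _ hx hM _ ih
  rw [rk_span_insert hA hM hx] at ih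
  omega

theorem eq_of_subset_of_rk_le {A B : Set P} (hA : Q.IsSubspace A) (hB : Q.IsSingular B)
    (h : A ⊆ B) (hr : Q.rk B ≤ Q.rk A) : A = B := by
  refine induction_up hB (p := fun A => Q.rk B ≤ Q.rk A → A = B) (fun _ => rfl) ?_ hA h hr
  intro A x hA _ _ hx hM hMB _ hr
  have h1 := rk_span_insert hA hM hx
  have h2 := rk_mono hM.1 hB hMB
  omega

/-- Half of the dimension formula of projective geometry. -/
theorem rk_add_rk_le {A B M : Set P} (hM : Q.IsSingular M) (hA : Q.IsSubspace A)
    (hB : Q.IsSubspace B) (hAM : A ⊆ M) (hBM : B ⊆ M) :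
    Q.rk A + Q.rk B ≤ Q.rk M + Q.rk (A ∩ B) := by
  refine induction_up hM (p := fun A => Q.rk A + Q.rk B ≤ Q.rk M + Q.rk (A ∩ B))
    (by rw [Set.inter_eq_right.2 hBM]) ?_ hA hAM
  intro A x hA hAM hxM hx hN hNM ih
  rw [rk_span_insert hA hN hx] at ih
  have hB' := hM.mono hB hBM
  set N := Q.span (insert x A)
  suffices h : Q.rk (N ∩ B) ≤ Q.rk (A ∩ B) + 1 by omega
  have hNB : Q.IsSingular (N ∩ B) := hN.inter hB
  have hAB : Q.IsSingular (A ∩ B) := hA.inter hB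
  have hsub : A ∩ B ⊆ N ∩ B := Set.inter_subset_inter_left _ (subset_span_insert x A)
  by_cases hz : N ∩ B ⊆ A
  · have : N ∩ B = A ∩ B := (Set.subset_inter hz Set.inter_subset_right).antisymm hsub
    rw [this]
    omega
  -- Otherwise `A ∩ B` is a hyperplane of `N ∩ B`.
  obtain ⟨z, hz, hzA⟩ := Set.not_subset.1 hz
  have hK : Q.span (insert z (A ∩ B)) ⊆ N ∩ B := span_subset hNB.1 (Set.insert_subset hz hsub)
  have hKs := hNB.mono (isSubspace_span _) hK
  rw [← rk_span_insert hAB hKs fun h => hzA h.1]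
  refine rk_mono hNB.1 hKs (hNB.subset_of_forall_line hKs.1 (H := A) hz hzA (mem_span_insert _ _)
    (fun L hL hLs => exists_mem_of_line_subset hA.1 hN hx hL fun y hy => (hLs hy).1) ?_)
  exact fun w hw => subset_span_insert z _ ⟨hw.2, hw.1.2⟩

theorem rk_le_rk_inter_perp_singleton {A : Set P} (hA : Q.IsSingular A) (y : P) :
    Q.rk A ≤ Q.rk (A ∩ Q.perp {y}) + 1 := by
  have hH := hA.inter (Q.isSubspace_perp {y})
  by_cases h : A ⊆ Q.perp {y}
  · rw [Set.inter_eq_left.2 h]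
    omega
  obtain ⟨z, hz, hyz⟩ := Set.not_subset.1 h
  have hK : Q.span (insert z (A ∩ Q.perp {y})) ⊆ A :=
    span_subset hA.1 (Set.insert_subset hz Set.inter_subset_left)
  have hKs := hA.mono (isSubspace_span _) hK
  rw [← rk_span_insert hH hKs fun h => hyz h.2]
  exact rk_mono hA.1 hKs (subset_of_perp_subset hA hKs.1 hz
    (fun h => hyz (mem_perp_singleton.2 h)) (mem_span_insert _ _)
    fun w hw hyw => subset_span_insert z _ ⟨hw, mem_perp_singleton.2 hyw⟩)

/-- Passing from `C` to `H` lowers the dimension of the perp inside `S` by at most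
`dim H - dim C`, since every further generator imposes one condition. -/
theorem rk_inter_perp_add_rk_le {S C H : Set P} (hS : Q.IsSingular S) (hH : Q.IsSingular H)
    (hC : Q.IsSubspace C) (hCH : C ⊆ H) :
    Q.rk (S ∩ Q.perp C) + Q.rk C ≤ Q.rk (S ∩ Q.perp H) + Q.rk H := by
  refine induction_up hH
    (p := fun C => Q.rk (S ∩ Q.perp C) + Q.rk C ≤ Q.rk (S ∩ Q.perp H) + Q.rk H) le_rfl ?_ hC hCH
  intro A x hA _ _ hx hM _ ih
  rw [rk_span_insert hA hM hx] at ih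
  have h1 := rk_le_rk_inter_perp_singleton (hS.inter (Q.isSubspace_perp A)) x
  have h2 : S ∩ Q.perp A ∩ Q.perp {x} ⊆ S ∩ Q.perp (Q.span (insert x A)) := by
    rintro y ⟨⟨hyS, hyA⟩, hyx⟩
    refine ⟨hyS, fun w hw => ?_⟩
    have : Q.span (insert x A) ⊆ Q.perp {y} := by
      refine span_subset (Q.isSubspace_perp _) (Set.insert_subset ?_ fun a ha => ?_)
      · exact mem_perp_singleton.2 (mem_perp_singleton.1 hyx).symm
      · exact mem_perp_singleton.2 (hyA a ha).symm
    exact (mem_perp_singleton.1 (this hw)).symm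
  have h3 := rk_mono ((hS.1.inter (Q.isSubspace_perp A)).inter (Q.isSubspace_perp {x}))
    (hS.inter (Q.isSubspace_perp _)) h2
  omega

theorem exists_subset_rk_eq {A : Set P} (hA : Q.IsSingular A) {k : ℕ} (hk : k ≤ Q.rk A) :
    ∃ C ⊆ A, Q.IsSingular C ∧ Q.rk C = k := by
  induction k with
  | zero => exact ⟨∅, Set.empty_subset _, Q.isSingular_empty, Q.rk_empty⟩
  | succ k ih =>
    obtain ⟨C, hCA, hC, hr⟩ := ih (by omega)
    obtain ⟨x, hxA, hx⟩ : ∃ x ∈ A, x ∉ C := by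
      by_contra! h
      have := rk_mono hA.1 hC h
      omega
    have hsub : Q.span (insert x C) ⊆ A := span_subset hA.1 (Set.insert_subset hxA hCA)
    have hs := hA.mono (isSubspace_span _) hsub
    exact ⟨_, hsub, hs, by rw [rk_span_insert hC hs hx, hr]⟩

theorem hasDim_iff {S : Set P} (hS : Q.IsSingular S) {d : ℤ} :
    Q.HasDim S d ↔ (Q.rk S : ℤ) = d + 1 := by
  have key : Q.HasDim S ((Q.rk S : ℤ) - 1) := by
    obtain ⟨X, hXc, hX⟩ := exists_span_eq hS
    refine ⟨⟨X, X.finite_toSet, ⟨hX ▸ subset_span _, fun Y hY hYX => ?_, hX⟩, ?_⟩, ?_⟩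
    · have hYf : Y.Finite := X.finite_toSet.subset hY.subset
      have h1 : Q.rk S ≤ hYf.toFinset.card := rk_le (by rw [hYf.coe_toFinset, hYX, hX])
      have h2 : hYf.toFinset.card < X.card := Finset.card_lt_card (by
        rw [← Finset.coe_ssubset, hYf.coe_toFinset]
        exact hY)
      omega
    · rw [Set.ncard_coe_finset, hXc]
      ring
    · rintro k ⟨Y, hYf, ⟨-, -, hY⟩, hYc⟩
      have h1 : Q.rk S ≤ hYf.toFinset.card := rk_le (by rw [hYf.coe_toFinset, hY])
      rw [← Set.ncard_eq_toFinset_card Y hYf] at h1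
      omega
  constructor
  · intro h
    have := h.unique key
    omega
  · intro h
    have : d = (Q.rk S : ℤ) - 1 := by omega
    exact this ▸ key

end PolarSpace

/-! ### Maximal singular subspaces and parity in type `D_n` -/

namespace PolarSpace

open PartialLinearSpace

variable {P : Type*} {Q : PolarSpace P} {n : ℕ}

theorem HasRank.rk_eq (h : Q.HasRank n) {M : Set P} (hM : Q.IsMaxSingular M) : Q.rk M = n := by
  have := (hasDim_iff hM.1).1 (h M hM)
  omega

theorem HasRank.rk_le (h : Q.HasRank n) {S : Set P} (hS : Q.IsSingular S) : Q.rk S ≤ n := by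
  obtain ⟨M, hM, hSM⟩ := exists_isMaxSingular hS
  exact h.rk_eq hM ▸ rk_mono hS.1 hM.1 hSM

theorem HasRank.isMaxSingular (h : Q.HasRank n) {S : Set P} (hS : Q.IsSingular S)
    (hr : Q.rk S = n) : Q.IsMaxSingular S := by
  obtain ⟨M, hM, hSM⟩ := exists_isMaxSingular hS
  exact eq_of_subset_of_rk_le hS.1 hM.1 hSM (by rw [h.rk_eq hM, hr]) ▸ hM

/-- A maximal singular subspace contains every point collinear with all its points. -/
theorem HasRank.mem_of_mem_perp (h : Q.HasRank n) {S : Set P} (hS : Q.IsSingular S)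
    (hr : Q.rk S = n) {x : P} (hx : x ∈ Q.perp S) : x ∈ S := by
  rw [(h.isMaxSingular hS hr).2 _ (isSingular_span_insert hS hx) (subset_span_insert x S)]
  exact mem_span_insert x S

theorem MaxGr.rk_eq (S : Q.MaxGr n) : Q.rk S.1 = n := by
  have := (hasDim_iff S.2.1).1 S.2.2
  omega

/-- The vertex of the dual polar graph given by a singular subspace of rank `n`. -/
def MaxGr.mk {S : Set P} (hS : Q.IsSingular S) (hr : Q.rk S = n) : Q.MaxGr n :=
  ⟨S, hS, (hasDim_iff hS).2 (by omega)⟩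

theorem MaxGr.isSingular_inter (S U : Q.MaxGr n) : Q.IsSingular (S.1 ∩ U.1) :=
  S.2.1.inter U.2.1.1

theorem MaxGr.rk_inter_le (S U : Q.MaxGr n) : Q.rk (S.1 ∩ U.1) ≤ n :=
  (rk_mono (S.isSingular_inter U).1 S.2.1 Set.inter_subset_left).trans S.rk_eq.le

theorem MaxGr.eq_of_subset {S U : Q.MaxGr n} (h : S.1 ⊆ U.1) : S = U :=
  Subtype.ext (eq_of_subset_of_rk_le S.2.1.1 U.2.1 h (by rw [S.rk_eq, U.rk_eq]))

theorem MaxGr.eq_of_le_rk_inter {S U : Q.MaxGr n} (h : n ≤ Q.rk (S.1 ∩ U.1)) : S = U := by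
  have : S.1 ∩ U.1 = S.1 := eq_of_subset_of_rk_le (S.isSingular_inter U).1 S.2.1
    Set.inter_subset_left (by rwa [S.rk_eq])
  exact MaxGr.eq_of_subset (Set.inter_eq_left.1 this)

theorem dualPolarGraph_adj {S U : Q.MaxGr n} :
    (Q.dualPolarGraph n).Adj S U ↔ Q.rk (S.1 ∩ U.1) + 1 = n := by
  have hd : Q.HasDim (S.1 ∩ U.1) ((n : ℤ) - 2) ↔ Q.rk (S.1 ∩ U.1) + 1 = n := by
    rw [hasDim_iff (S.isSingular_inter U)]
    omega
  refine ⟨fun h => hd.1 h.2, fun h => ⟨?_, hd.2 h⟩⟩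
  rintro rfl
  rw [Set.inter_self, S.rk_eq] at h
  omega

theorem halfSpinGraph_adj {S₀ : Q.MaxGr n} {δ : Bool} {S U : halfSpin S₀ δ} :
    (halfSpinGraph S₀ δ).Adj S U ↔ Q.rk (S.1.1 ∩ U.1.1) + 2 = n := by
  have hd : Q.HasDim (S.1.1 ∩ U.1.1) ((n : ℤ) - 3) ↔ Q.rk (S.1.1 ∩ U.1.1) + 2 = n := by
    rw [hasDim_iff (S.1.isSingular_inter U.1)]
    omega
  refine ⟨fun h => hd.1 h.2, fun h => ⟨?_, hd.2 h⟩⟩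
  rintro rfl
  rw [Set.inter_self, S.1.rk_eq] at h
  omega

theorem mem_special {S₀ : Q.MaxGr n} {δ : Bool} {U : halfSpin S₀ (!δ)} {S : halfSpin S₀ δ} :
    S ∈ special S₀ δ U ↔ (Q.dualPolarGraph n).Adj S.1 U.1 := by
  rw [dualPolarGraph_adj]
  change Q.HasDim _ _ ↔ _
  rw [hasDim_iff (S.1.isSingular_inter U.1)]
  omega

/-- Three maximal singular subspaces cannot share a hyperplane. -/
theorem IsTypeD.eq_or_eq_of_subset (hQ : Q.IsTypeD n) {N : Set P} (hN : Q.IsSingular N)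
    (hr : Q.rk N + 1 = n) {S U T : Q.MaxGr n} (hS : N ⊆ S.1) (hU : N ⊆ U.1) (hT : N ⊆ T.1) :
    S = U ∨ T = S ∨ T = U := by
  obtain ⟨A, B, -, hAB⟩ := Set.encard_eq_two.1
    (hQ.2 N hN ((hasDim_iff hN).2 (by omega)))
  have key : ∀ M : Q.MaxGr n, N ⊆ M.1 → M.1 = A ∨ M.1 = B := by
    intro M hM
    have : M.1 ∈ {S : Set P | Q.IsMaxSingular S ∧ N ⊆ S} :=
      ⟨hQ.1.isMaxSingular M.2.1 M.rk_eq, hM⟩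
    rw [hAB] at this
    exact this
  simp only [Subtype.ext_iff]
  rcases key S hS with h1 | h1 <;> rcases key U hU with h2 | h2 <;>
    rcases key T hT with h3 | h3 <;> simp [h1, h2, h3]

/-- Moving along an edge `UV` of the dual polar graph changes the dimension of the intersection
with a fixed maximal singular subspace `S` by exactly one. -/
theorem IsTypeD.rk_inter_of_adj (hQ : Q.IsTypeD n) (S : Q.MaxGr n) {U V : Q.MaxGr n}
    (hUV : (Q.dualPolarGraph n).Adj U V) :
    Q.rk (S.1 ∩ U.1) = Q.rk (S.1 ∩ V.1) + 1 ∨ Q.rk (S.1 ∩ V.1) = Q.rk (S.1 ∩ U.1) + 1 := by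
  have hne := hUV.ne
  have hH := U.isSingular_inter V
  have hrH := dualPolarGraph_adj.1 hUV
  set H := U.1 ∩ V.1 with hHdef
  have hSH : Q.IsSingular (S.1 ∩ H) := S.2.1.inter hH.1
  have hUH : S.1 ∩ H ⊆ S.1 ∩ U.1 := Set.inter_subset_inter_right _ Set.inter_subset_left
  have hVH : S.1 ∩ H ⊆ S.1 ∩ V.1 := Set.inter_subset_inter_right _ Set.inter_subset_right
  have hU1 := rk_mono hSH.1 (S.isSingular_inter U) hUH
  have hV1 := rk_mono hSH.1 (S.isSingular_inter V) hVH
  have hU2 := rk_add_rk_le U.2.1 (S.isSingular_inter U).1 hH.1 Set.inter_subset_right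
    Set.inter_subset_left
  have hV2 := rk_add_rk_le V.2.1 (S.isSingular_inter V).1 hH.1 Set.inter_subset_right
    Set.inter_subset_right
  have hU3 : S.1 ∩ U.1 ∩ H = S.1 ∩ H := by
    rw [Set.inter_assoc, Set.inter_eq_right.2 (Set.inter_subset_left : H ⊆ U.1)]
  have hV3 : S.1 ∩ V.1 ∩ H = S.1 ∩ H := by
    rw [Set.inter_assoc, Set.inter_eq_right.2 (Set.inter_subset_right : H ⊆ V.1)]
  rw [hU3, U.rk_eq] at hU2
  rw [hV3, V.rk_eq] at hV2
  by_cases hUS : S.1 ∩ U.1 ⊆ H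
  · by_cases hVS : S.1 ∩ V.1 ⊆ H
    · exfalso
      -- Some point of `S` outside `H` is collinear with all of `H`, hence lies in `U` or `V`.
      have h1 := rk_inter_perp_add_rk_le S.2.1 hH hSH.1 Set.inter_subset_right
      have h2 : S.1 ∩ Q.perp (S.1 ∩ H) = S.1 :=
        Set.inter_eq_left.2 fun y hy x hx => S.2.1.2 x hx.1 y hy
      rw [h2, S.rk_eq] at h1
      obtain ⟨x, hx, hxH⟩ : ∃ x ∈ S.1 ∩ Q.perp H, x ∉ H := by
        by_contra! hcon
        have := rk_mono (S.2.1.1.inter (Q.isSubspace_perp H)) hSH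
          (Set.subset_inter Set.inter_subset_left hcon)
        omega
      have hT := isSingular_span_insert hH hx.2
      have hTr := rk_span_insert hH hT hxH
      let T : Q.MaxGr n := MaxGr.mk hT (by omega)
      have hxT : x ∈ T.1 := mem_span_insert x H
      rcases hQ.eq_or_eq_of_subset hH hrH (S := U) (U := V) (T := T) Set.inter_subset_left
        Set.inter_subset_right (subset_span_insert x H) with h | h | h
      · exact hne h
      · exact hxH (hUS ⟨hx.1, h ▸ hxT⟩)
      · exact hxH (hVS ⟨hx.1, h ▸ hxT⟩)
    · right
      have : ¬ Q.rk (S.1 ∩ V.1) ≤ Q.rk (S.1 ∩ H) := fun h => hVS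
        (eq_of_subset_of_rk_le hSH.1 (S.isSingular_inter V) hVH h ▸ Set.inter_subset_right)
      have := rk_mono (S.isSingular_inter U).1 hSH (Set.subset_inter Set.inter_subset_left hUS)
      omega
  · have h1 : ¬ Q.rk (S.1 ∩ U.1) ≤ Q.rk (S.1 ∩ H) := fun h => hUS
      (eq_of_subset_of_rk_le hSH.1 (S.isSingular_inter U) hUH h ▸ Set.inter_subset_right)
    by_cases hVS : S.1 ∩ V.1 ⊆ H
    · left
      have := rk_mono (S.isSingular_inter V).1 hSH (Set.subset_inter Set.inter_subset_left hVS)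
      omega
    · exfalso
      -- `U` is spanned by `H` and a point of `S`, so a point of `S ∩ V` outside `H` is collinear
      -- with all of `U`.
      obtain ⟨x, hx, hxH⟩ := Set.not_subset.1 hUS
      obtain ⟨y, hy, hyH⟩ := Set.not_subset.1 hVS
      have hsub : Q.span (insert x H) ⊆ U.1 :=
        span_subset U.2.1.1 (Set.insert_subset hx.2 Set.inter_subset_left)
      have hs := U.2.1.mono (isSubspace_span _) hsub
      have hr := rk_span_insert hH hs hxH
      have hUeq := eq_of_subset_of_rk_le hs.1 U.2.1 hsub (by rw [U.rk_eq]; omega)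
      refine hyH ⟨hQ.1.mem_of_mem_perp U.2.1 U.rk_eq ?_, hy.2⟩
      intro u hu
      rw [← hUeq] at hu
      refine (mem_perp_singleton.1 (span_subset (Q.isSubspace_perp {y})
        (Set.insert_subset ?_ fun h hh => ?_) hu)).symm
      · exact mem_perp_singleton.2 (S.2.1.2 y hy.1 x hx.1)
      · exact mem_perp_singleton.2 (V.2.1.2 y hy.2 h hh.2)

theorem IsTypeD.even_length_add (hQ : Q.IsTypeD n) (T : Q.MaxGr n) {S U : Q.MaxGr n}
    (w : (Q.dualPolarGraph n).Walk S U) :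
    Even (w.length + Q.rk (T.1 ∩ S.1) + Q.rk (T.1 ∩ U.1)) := by
  induction w with
  | nil => simp
  | cons h w ih =>
    rw [SimpleGraph.Walk.length_cons]
    rcases hQ.rk_inter_of_adj T h with h | h <;> rw [Nat.even_iff] at * <;> omega

theorem HasRank.reachable (hQ : Q.HasRank n) (S U : Q.MaxGr n) :
    (Q.dualPolarGraph n).Reachable S U := by
  induction hk : n - Q.rk (S.1 ∩ U.1) using Nat.strong_induction_on generalizing U with
  | _ k ih =>
    by_cases hSU : S = U
    · exact hSU ▸ SimpleGraph.Reachable.refl _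
    obtain ⟨p, hpS, hpU⟩ := Set.not_subset.1 fun h => hSU (MaxGr.eq_of_subset h)
    -- Replace `U` by its neighbour spanned by `p` and the part of `U` collinear with `p`.
    have hH := U.2.1.inter (Q.isSubspace_perp {p})
    have hp : p ∈ Q.perp (U.1 ∩ Q.perp {p}) := fun x hx => (mem_perp_singleton.1 hx.2).symm
    have hV := isSingular_span_insert hH hp
    have hVr := rk_span_insert hH hV fun h => hpU h.1
    have h1 := rk_le_rk_inter_perp_singleton U.2.1 p
    have h2 := hQ.rk_le hV
    rw [U.rk_eq] at h1
    let V : Q.MaxGr n := MaxGr.mk hV (by omega)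
    have hpV : p ∈ V.1 := mem_span_insert p _
    have hHV : U.1 ∩ Q.perp {p} ⊆ V.1 := subset_span_insert p _
    have hVU : (Q.dualPolarGraph n).Adj V U := by
      rw [dualPolarGraph_adj]
      have h3 := rk_mono hH.1 (V.isSingular_inter U)
        (Set.subset_inter hHV Set.inter_subset_left)
      have h4 : ¬ n ≤ Q.rk (V.1 ∩ U.1) := fun h => hpU (MaxGr.eq_of_le_rk_inter h ▸ hpV)
      omega
    refine (ih _ ?_ V rfl).trans hVU.reachable
    have hsub : S.1 ∩ U.1 ⊆ S.1 ∩ V.1 := fun x hx =>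
      ⟨hx.1, hHV ⟨hx.2, mem_perp_singleton.2 (S.2.1.2 p hpS x hx.1)⟩⟩
    have h5 : ¬ Q.rk (S.1 ∩ V.1) ≤ Q.rk (S.1 ∩ U.1) := by
      intro h
      have := eq_of_subset_of_rk_le (S.isSingular_inter U).1 (S.isSingular_inter V) hsub h
      exact hpU (this.symm ▸ (⟨hpS, hpV⟩ : p ∈ S.1 ∩ V.1) : p ∈ S.1 ∩ U.1).2
    have := S.rk_inter_le V
    omega

theorem IsTypeD.mem_halfSpin (hQ : Q.IsTypeD n) {S₀ S : Q.MaxGr n} {δ : Bool} :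
    S ∈ halfSpin S₀ δ ↔ (Even (n + Q.rk (S₀.1 ∩ S.1)) ↔ δ = true) := by
  obtain ⟨w, hw⟩ := (hQ.1.reachable S₀ S).exists_walk_length_eq_dist
  have h := hQ.even_length_add S₀ w
  rw [Set.inter_self, S₀.rk_eq, hw, add_assoc] at h
  change (Even _ ↔ _) ↔ _
  rw [Nat.even_add.1 h]

/-- Distances inside a half-spin Grassmannian are even. -/
theorem IsTypeD.even_of_halfSpin (hQ : Q.IsTypeD n) {S₀ : Q.MaxGr n} {δ : Bool}
    (S U : halfSpin S₀ δ) : Even (n + Q.rk (S.1.1 ∩ U.1.1)) := by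
  obtain ⟨w⟩ := hQ.1.reachable S.1 U.1
  have h1 := hQ.even_length_add S₀ w
  have h2 := hQ.even_length_add S.1 w
  rw [Set.inter_self, S.1.rk_eq] at h2
  have h3 := (hQ.mem_halfSpin.1 S.2).trans (hQ.mem_halfSpin.1 U.2).symm
  simp only [Nat.even_iff] at *
  omega

theorem IsTypeD.not_mem_halfSpin (hQ : Q.IsTypeD n) {S₀ S : Q.MaxGr n} {δ : Bool} :
    S ∈ halfSpin S₀ (!δ) ↔ S ∉ halfSpin S₀ δ := by
  rw [hQ.mem_halfSpin, hQ.mem_halfSpin]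
  cases δ <;> simp

/-- The dual polar graph is bipartite, with the two half-spin Grassmannians as its parts. -/
theorem IsTypeD.mem_halfSpin_of_adj (hQ : Q.IsTypeD n) {S₀ S U : Q.MaxGr n} {δ : Bool}
    (hS : S ∈ halfSpin S₀ δ) (h : (Q.dualPolarGraph n).Adj S U) : U ∈ halfSpin S₀ (!δ) := by
  rw [hQ.not_mem_halfSpin]
  intro hU
  have h1 := hQ.even_of_halfSpin ⟨S, hS⟩ ⟨U, hU⟩
  have h2 := dualPolarGraph_adj.1 h
  simp only [Nat.even_iff] at h1
  omega

/-! ### Special subspaces and lines of the half-spin graph -/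

theorem le_rk_inter_inter_of_adj {S T U : Q.MaxGr n} (hS : (Q.dualPolarGraph n).Adj S U)
    (hT : (Q.dualPolarGraph n).Adj T U) : n ≤ Q.rk (S.1 ∩ T.1 ∩ U.1) + 2 := by
  have h := rk_add_rk_le U.2.1 (S.isSingular_inter U).1 (T.isSingular_inter U).1
    Set.inter_subset_right Set.inter_subset_right
  rw [← Set.inter_inter_distrib_right, U.rk_eq] at h
  have h1 := dualPolarGraph_adj.1 hS
  have h2 := dualPolarGraph_adj.1 hT
  omega

theorem le_rk_inter_of_adj {S T U : Q.MaxGr n} (hS : (Q.dualPolarGraph n).Adj S U)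
    (hT : (Q.dualPolarGraph n).Adj T U) : n ≤ Q.rk (S.1 ∩ T.1) + 2 := by
  have h := rk_mono ((S.isSingular_inter T).inter U.2.1.1).1 (S.isSingular_inter T)
    Set.inter_subset_left
  have := le_rk_inter_inter_of_adj hS hT
  omega

theorem IsTypeD.eq_or_adj (hQ : Q.IsTypeD n) {S₀ : Q.MaxGr n} {δ : Bool} {S T : halfSpin S₀ δ}
    (h : n ≤ Q.rk (S.1.1 ∩ T.1.1) + 2) : S = T ∨ (halfSpinGraph S₀ δ).Adj S T := by
  by_cases hST : S = T
  · exact Or.inl hST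
  right
  rw [halfSpinGraph_adj]
  have h1 := hQ.even_of_halfSpin S T
  have h2 : ¬ n ≤ Q.rk (S.1.1 ∩ T.1.1) := fun h =>
    hST (Subtype.ext (MaxGr.eq_of_le_rk_inter h))
  rw [Nat.even_iff] at h1
  omega

/-- Special subspaces are cliques of the half-spin graph. -/
theorem IsTypeD.eq_or_adj_of_adj (hQ : Q.IsTypeD n) {S₀ : Q.MaxGr n} {δ : Bool}
    {S T : halfSpin S₀ δ} {U : Q.MaxGr n} (hS : (Q.dualPolarGraph n).Adj S.1 U)
    (hT : (Q.dualPolarGraph n).Adj T.1 U) : S = T ∨ (halfSpinGraph S₀ δ).Adj S T :=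
  hQ.eq_or_adj (le_rk_inter_of_adj hS hT)

/-- A vertex `X` of the half-spin graph that is adjacent to two points `A`, `B` of a line is
adjacent or equal to each further point `D` of that line. -/
theorem IsTypeD.eq_or_adj_of_line (hQ : Q.IsTypeD n) {S₀ : Q.MaxGr n} {δ : Bool}
    {X A B D : halfSpin S₀ δ} (hXA : (halfSpinGraph S₀ δ).Adj X A)
    (hXB : (halfSpinGraph S₀ δ).Adj X B) (hAB : (halfSpinGraph S₀ δ).Adj A B)
    (hD : A.1.1 ∩ B.1.1 ⊆ D.1.1) : X = D ∨ (halfSpinGraph S₀ δ).Adj X D := by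
  apply hQ.eq_or_adj
  rw [halfSpinGraph_adj] at hXA hXB hAB
  have hN := A.1.isSingular_inter B.1
  set N := A.1.1 ∩ B.1.1 with hNdef
  have hXN : Q.IsSingular (X.1.1 ∩ N) := X.1.2.1.inter hN.1
  by_cases hNX : N ⊆ X.1.1
  · have := rk_mono hN.1 (X.1.isSingular_inter D.1) (Set.subset_inter hNX hD)
    omega
  have hXNr : Q.rk (X.1.1 ∩ N) < Q.rk N := by
    by_contra! h
    exact hNX (Set.inter_eq_right.1
      (eq_of_subset_of_rk_le hXN.1 hN Set.inter_subset_right h))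
  -- `W` is the part of `X` spanned by its traces on `A` and `B`; it is collinear with `N`.
  set W := Q.span (X.1.1 ∩ A.1.1 ∪ X.1.1 ∩ B.1.1) with hWdef
  have hWX : W ⊆ X.1.1 :=
    span_subset X.1.2.1.1 (Set.union_subset Set.inter_subset_left Set.inter_subset_left)
  have hW : Q.IsSingular W := X.1.2.1.mono (isSubspace_span _) hWX
  have h1 := rk_add_rk_le hW (X.1.isSingular_inter A.1).1 (X.1.isSingular_inter B.1).1
    (Set.subset_union_left.trans (subset_span _)) (Set.subset_union_right.trans (subset_span _))
  rw [← Set.inter_inter_distrib_left, ← hNdef] at h1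
  have hNW : N ⊆ Q.perp W := by
    intro y hy w hw
    refine (mem_perp_singleton.1 (span_subset (Q.isSubspace_perp {y}) ?_ hw)).symm
    rintro x (hx | hx)
    · exact mem_perp_singleton.2 (A.1.2.1.2 y hy.1 x hx.2)
    · exact mem_perp_singleton.2 (B.1.2.1.2 y hy.2 x hx.2)
  have hZ := isSingular_span_union hW hN hNW
  have hWZ : W ⊆ Q.span (W ∪ N) := Set.subset_union_left.trans (subset_span _)
  have hNZ : N ⊆ Q.span (W ∪ N) := Set.subset_union_right.trans (subset_span _)
  have h2 := rk_add_rk_le hZ hW.1 hN.1 hWZ hNZ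
  have h3 := rk_mono (hW.inter hN.1).1 hXN (Set.inter_subset_inter_left _ hWX)
  have h4 := hQ.1.rk_le hZ
  -- Counting dimensions, `⟨W, N⟩` is a maximal singular subspace adjacent to `X` and `D`.
  let Z : Q.MaxGr n := MaxGr.mk hZ (by omega)
  have hXZ : (Q.dualPolarGraph n).Adj X.1 Z := by
    rw [dualPolarGraph_adj]
    have h5 := rk_mono hW.1 (X.1.isSingular_inter Z) (Set.subset_inter hWX hWZ)
    have h6 : ¬ n ≤ Q.rk (X.1.1 ∩ Z.1) := fun h =>
      hNX ((MaxGr.eq_of_le_rk_inter h).symm ▸ hNZ : N ⊆ X.1.1)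
    omega
  have hDZ : (Q.dualPolarGraph n).Adj D.1 Z := by
    rw [dualPolarGraph_adj]
    have h5 := rk_mono hN.1 (D.1.isSingular_inter Z) (Set.subset_inter hD hNZ)
    have h6 := hQ.even_of_halfSpin D X
    have h7 := D.1.rk_inter_le Z
    rw [Nat.even_iff] at h6
    rcases hQ.rk_inter_of_adj D.1 hXZ with h | h <;> omega
  exact le_rk_inter_of_adj hXZ hDZ

theorem IsTypeD.inter_subset_of_adj (hQ : Q.IsTypeD n) {S₀ : Q.MaxGr n} {δ : Bool}
    {U V : halfSpin S₀ δ} (hUV : U ≠ V) {S : Q.MaxGr n} (hU : (Q.dualPolarGraph n).Adj U.1 S)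
    (hV : (Q.dualPolarGraph n).Adj V.1 S) : U.1.1 ∩ V.1.1 ⊆ S.1 := by
  have h1 := halfSpinGraph_adj.1 ((hQ.eq_or_adj_of_adj hU hV).resolve_left hUV)
  have h2 := le_rk_inter_inter_of_adj hU hV
  exact Set.inter_eq_left.1 (eq_of_subset_of_rk_le
    ((U.1.isSingular_inter V.1).inter S.2.1.1).1 (U.1.isSingular_inter V.1)
    Set.inter_subset_left (by omega))

/-- If two special subspaces `[U]` and `[V]` share adjacent `A`, `B` and a further `D`, these lie
on a line, so a vertex `X` adjacent to `A` and `B` but not to `D` forces `U = V`. -/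
theorem IsTypeD.eq_of_special (hQ : Q.IsTypeD n) {S₀ : Q.MaxGr n} {δ : Bool}
    {X A B D : halfSpin S₀ δ} (hXA : (halfSpinGraph S₀ δ).Adj X A)
    (hXB : (halfSpinGraph S₀ δ).Adj X B) (hAB : (halfSpinGraph S₀ δ).Adj A B)
    (hXD : X ≠ D) (hXD' : ¬ (halfSpinGraph S₀ δ).Adj X D) {U V : halfSpin S₀ (!δ)}
    (hAU : A ∈ special S₀ δ U) (hBU : B ∈ special S₀ δ U) (hDU : D ∈ special S₀ δ U)
    (hAV : A ∈ special S₀ δ V) (hBV : B ∈ special S₀ δ V) (hDV : D ∈ special S₀ δ V) :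
    U = V := by
  by_contra hUV
  rw [mem_special] at *
  have hA := hQ.inter_subset_of_adj hUV hAU.symm hAV.symm
  have hB := hQ.inter_subset_of_adj hUV hBU.symm hBV.symm
  have hD := hQ.inter_subset_of_adj hUV hDU.symm hDV.symm
  have h1 := le_rk_inter_of_adj hAU.symm hAV.symm
  have h2 := halfSpinGraph_adj.1 hAB
  have h3 := eq_of_subset_of_rk_le (U.1.isSingular_inter V.1).1 (A.1.isSingular_inter B.1)
    (Set.subset_inter hA hB) (by omega)
  exact (hQ.eq_or_adj_of_line hXA hXB hAB (h3 ▸ hD)).elim hXD hXD'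

/-- Distinct neighbours `U₁`, `U₂` of `S` and a vertex `T` adjacent to both that meets `S` in
codimension two determine `S ∩ T`. -/
theorem IsTypeD.inter_eq_of_adj (hQ : Q.IsTypeD n) {S T U₁ U₂ : Q.MaxGr n}
    (hS₁ : (Q.dualPolarGraph n).Adj S U₁) (hS₂ : (Q.dualPolarGraph n).Adj S U₂)
    (hT₁ : (Q.dualPolarGraph n).Adj T U₁) (hT₂ : (Q.dualPolarGraph n).Adj T U₂) (hU : U₁ ≠ U₂)
    (hST : Q.rk (S.1 ∩ T.1) + 2 = n) : S.1 ∩ U₁.1 ∩ U₂.1 = S.1 ∩ T.1 := by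
  have key : ∀ U : Q.MaxGr n, (Q.dualPolarGraph n).Adj S U → (Q.dualPolarGraph n).Adj T U →
      S.1 ∩ T.1 ⊆ U.1 := by
    intro U hSU hTU
    have := le_rk_inter_inter_of_adj hSU hTU
    exact Set.inter_eq_left.1 (eq_of_subset_of_rk_le
      ((S.isSingular_inter T).inter U.2.1.1).1 (S.isSingular_inter T)
      Set.inter_subset_left (by omega))
  have hSU := (S.isSingular_inter U₁).inter U₂.2.1.1
  symm
  refine eq_of_subset_of_rk_le (S.isSingular_inter T).1 hSU
    (Set.subset_inter (Set.subset_inter Set.inter_subset_left (key _ hS₁ hT₁)) (key _ hS₂ hT₂)) ?_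
  by_contra! hlt
  -- Otherwise `S`, `U₁`, `U₂` share a hyperplane.
  have h1 := rk_mono hSU.1 (S.isSingular_inter U₁) Set.inter_subset_left
  have h2 := dualPolarGraph_adj.1 hS₁
  rcases hQ.eq_or_eq_of_subset hSU (by omega) (S := U₁) (U := U₂) (T := S)
    (Set.inter_subset_left.trans Set.inter_subset_right) Set.inter_subset_right
    (Set.inter_subset_left.trans Set.inter_subset_left) with h | h | h
  · exact hU h
  · exact hS₁.ne h
  · exact hS₂.ne h

end PolarSpace

/-! ### Hypercubes -/

section Cube

variable {m : ℕ}

/-- The neighbour of the vertex `v` of the hypercube in direction `i`. -/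
def cubeFlip (v : Fin m → Bool) (i : Fin m) : Fin m → Bool := Function.update v i (!v i)

@[simp]
theorem cubeFlip_self (v : Fin m → Bool) (i : Fin m) : cubeFlip v i i = !v i :=
  Function.update_self ..

@[simp]
theorem cubeFlip_of_ne (v : Fin m → Bool) {i j : Fin m} (h : j ≠ i) : cubeFlip v i j = v j :=
  Function.update_of_ne h ..

theorem cubeFlip_cubeFlip (v : Fin m → Bool) (i : Fin m) : cubeFlip (cubeFlip v i) i = v := by
  ext j
  by_cases h : j = i
  · subst h
    simp
  · simp [h]

theorem cubeFlip_comm (v : Fin m → Bool) (i j : Fin m) :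
    cubeFlip (cubeFlip v i) j = cubeFlip (cubeFlip v j) i := by
  ext k
  by_cases hi : k = i <;> by_cases hj : k = j <;> simp_all [cubeFlip, Function.update_apply]

theorem hammingDist_cubeFlip_of_eq {v w : Fin m → Bool} {i : Fin m} (h : v i = w i) :
    hammingDist (cubeFlip v i) w = hammingDist v w + 1 := by
  have hset : (Finset.univ.filter fun j => cubeFlip v i j ≠ w j) =
      insert i (Finset.univ.filter fun j => v j ≠ w j) := by
    ext j
    by_cases hj : j = i
    · subst hj
      simp [h]
    · simp [hj]
  unfold hammingDist
  rw [hset, Finset.card_insert_of_notMem (by simp [h])]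

theorem hammingDist_cubeFlip_of_ne {v w : Fin m → Bool} {i : Fin m} (h : v i ≠ w i) :
    hammingDist v w = hammingDist (cubeFlip v i) w + 1 := by
  have h' : cubeFlip v i i = w i := by
    rw [cubeFlip_self]
    cases hv : v i <;> cases hw : w i <;> simp_all
  rw [← hammingDist_cubeFlip_of_eq h', cubeFlip_cubeFlip]

theorem hammingDist_cubeFlip_self (v : Fin m → Bool) (i : Fin m) :
    hammingDist (cubeFlip v i) v = 1 := by
  rw [hammingDist_cubeFlip_of_eq rfl, hammingDist_self]

theorem even_hammingDist_add (v w : Fin m → Bool) :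
    Even (hammingDist v w + cubeWeight v + cubeWeight w) := by
  unfold hammingDist cubeWeight
  simp only [Finset.card_filter]
  rw [← Finset.sum_add_distrib, ← Finset.sum_add_distrib]
  refine Finset.even_sum _ fun i _ => ?_
  cases v i <;> cases w i <;> decide

theorem hypercubeGraph_adj_cubeFlip (v : Fin m → Bool) (i : Fin m) :
    (hypercubeGraph m).Adj (cubeFlip v i) v := hammingDist_cubeFlip_self v i

theorem even_cubeWeight_cubeFlip (v : Fin m → Bool) (i : Fin m) :
    Even (cubeWeight (cubeFlip v i)) ↔ Odd (cubeWeight v) := by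
  have h := even_hammingDist_add (cubeFlip v i) v
  rw [hammingDist_cubeFlip_self] at h
  simp only [Nat.even_iff, Nat.odd_iff] at *
  omega

theorem odd_cubeWeight_cubeFlip (v : Fin m → Bool) (i : Fin m) :
    Odd (cubeWeight (cubeFlip v i)) ↔ Even (cubeWeight v) := by
  rw [← Nat.not_even_iff_odd, even_cubeWeight_cubeFlip, Nat.not_odd_iff_even]

/-- Two vertices of the hypercube at distance two differ by two flips. -/
theorem exists_eq_cubeFlip_cubeFlip {v w : Fin m → Bool} (h : hammingDist v w = 2) :
    ∃ a b, a ≠ b ∧ v a ≠ w a ∧ v b ≠ w b ∧ v = cubeFlip (cubeFlip w a) b := by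
  obtain ⟨a, b, hab, hset⟩ := Finset.card_eq_two.1 h
  have key : ∀ i, v i ≠ w i ↔ i = a ∨ i = b := fun i => by
    have := Finset.ext_iff.1 hset i
    simpa using this
  have ha := (key a).2 (Or.inl rfl)
  have hb := (key b).2 (Or.inr rfl)
  refine ⟨a, b, hab, ha, hb, funext fun i => ?_⟩
  by_cases hib : i = b
  · subst hib
    rw [cubeFlip_self, cubeFlip_of_ne _ hab.symm]
    exact Bool.eq_not.2 hb
  · by_cases hia : i = a
    · subst hia
      rw [cubeFlip_of_ne _ hib, cubeFlip_self]
      exact Bool.eq_not.2 ha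
    · rw [cubeFlip_of_ne _ hib, cubeFlip_of_ne _ hia]
      by_contra h
      exact ((key i).1 h).elim hia hib

/-- Some neighbour of `v` is farther from `w` than `v`, unless `w` is antipodal to `v`; in that
case all neighbours of `v` are at distance `m - 1` from `w`. -/
theorem exists_le_hammingDist_cubeFlip (hm : 0 < m) (v w : Fin m → Bool) :
    ∃ i, min (hammingDist v w + 1) (m - 1) ≤ hammingDist (cubeFlip v i) w := by
  by_cases h : ∃ i, v i = w i
  · obtain ⟨i, hi⟩ := h
    exact ⟨i, by rw [hammingDist_cubeFlip_of_eq hi]; exact min_le_left _ _⟩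
  · push Not at h
    refine ⟨⟨0, hm⟩, (min_le_right _ _).trans ?_⟩
    have h1 := hammingDist_cubeFlip_of_ne (h ⟨0, hm⟩)
    have h2 : hammingDist v w = m := by
      unfold hammingDist
      rw [Finset.filter_true_of_mem fun i _ => h i, Finset.card_univ, Fintype.card_fin]
    omega

/-- The even vertex adjacent in direction `i` to an odd vertex. -/
def OddVertex.flip (u : OddVertex m) (i : Fin m) : EvenVertex m :=
  ⟨cubeFlip u.1 i, (even_cubeWeight_cubeFlip u.1 i).2 u.2⟩

theorem OddVertex.flip_mem (u : OddVertex m) (i : Fin m) : u.flip i ∈ cubeSpecial u :=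
  hypercubeGraph_adj_cubeFlip u.1 i

end Cube

/-! ### Embeddings of half-cubes -/

namespace PolarSpace

open PartialLinearSpace

variable {P : Type*} {Q : PolarSpace P} {m n : ℕ} {S₀ : Q.MaxGr n} {δ : Bool}

/-- A special subset of the half-cube is mapped into at most one special subspace. -/
theorem IsTypeD.special_unique (hQ : Q.IsTypeD n) (hm : 4 ≤ m)
    (f : halfCubeGraph m ↪g halfSpinGraph S₀ δ) (u : OddVertex m) {U V : halfSpin S₀ (!δ)}
    (hU : f '' cubeSpecial u ⊆ special S₀ δ U) (hV : f '' cubeSpecial u ⊆ special S₀ δ V) :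
    U = V := by
  obtain ⟨i, j, k, l, hij, hik, hil, hjk, hjl, hkl⟩ : ∃ i j k l : Fin m,
      i ≠ j ∧ i ≠ k ∧ i ≠ l ∧ j ≠ k ∧ j ≠ l ∧ k ≠ l :=
    ⟨⟨0, by omega⟩, ⟨1, by omega⟩, ⟨2, by omega⟩, ⟨3, by omega⟩, by simp⟩
  -- The vertex `x` is adjacent in the half-cube to `u + eᵢ` and `u + eⱼ`, but not to `u + eₗ`.
  let x : EvenVertex m := ⟨cubeFlip (cubeFlip (cubeFlip u.1 i) j) k, by
    rw [even_cubeWeight_cubeFlip, odd_cubeWeight_cubeFlip, even_cubeWeight_cubeFlip]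
    exact u.2⟩
  have hxi : hammingDist x.1 (u.flip i).1 = 2 := by
    change hammingDist (cubeFlip (cubeFlip (cubeFlip u.1 i) j) k) (cubeFlip u.1 i) = 2
    rw [hammingDist_cubeFlip_of_eq (by simp [hjk.symm]), hammingDist_cubeFlip_self]
  have hxj : hammingDist x.1 (u.flip j).1 = 2 := by
    change hammingDist (cubeFlip (cubeFlip (cubeFlip u.1 i) j) k) (cubeFlip u.1 j) = 2
    rw [cubeFlip_comm u.1 i j, hammingDist_cubeFlip_of_eq (by simp [hik.symm]),
      hammingDist_cubeFlip_self]
  have hij' : hammingDist (u.flip i).1 (u.flip j).1 = 2 := by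
    change hammingDist (cubeFlip u.1 i) (cubeFlip u.1 j) = 2
    rw [hammingDist_cubeFlip_of_eq (by simp [hij]), hammingDist_comm, hammingDist_cubeFlip_self]
  have hxl : hammingDist x.1 (u.flip l).1 = 4 := by
    change hammingDist (cubeFlip (cubeFlip (cubeFlip u.1 i) j) k) (cubeFlip u.1 l) = 4
    rw [hammingDist_cubeFlip_of_eq (by simp [hik.symm, hjk.symm, hkl]),
      hammingDist_cubeFlip_of_eq (by simp [hij.symm, hjl]),
      hammingDist_cubeFlip_of_eq (by simp [hil]), hammingDist_comm, hammingDist_cubeFlip_self]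
  have hmem : ∀ {W : halfSpin S₀ (!δ)}, f '' cubeSpecial u ⊆ special S₀ δ W → ∀ i,
      f (u.flip i) ∈ special S₀ δ W := fun h i => h (Set.mem_image_of_mem f (u.flip_mem i))
  refine hQ.eq_of_special (X := f x) (A := f (u.flip i)) (B := f (u.flip j)) (D := f (u.flip l))
    (f.map_adj_iff.2 hxi) (f.map_adj_iff.2 hxj) (f.map_adj_iff.2 hij') ?_ ?_ (hmem hU i)
    (hmem hU j) (hmem hU l) (hmem hV i) (hmem hV j) (hmem hV l)
  · intro h
    rw [f.injective h, hammingDist_self] at hxl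
    omega
  · rw [f.map_adj_iff]
    intro h
    have : hammingDist x.1 (u.flip l).1 = 2 := h
    omega

/-- If `[U]` contains the image of the special subset given by `u`, it contains no further point
of the image, because special subspaces are cliques. -/
theorem IsTypeD.mem_special_iff (hQ : Q.IsTypeD n) (hm : 4 ≤ m)
    (f : halfCubeGraph m ↪g halfSpinGraph S₀ δ) {u : OddVertex m} {U : halfSpin S₀ (!δ)}
    (hU : f '' cubeSpecial u ⊆ special S₀ δ U) (v : EvenVertex m) :
    f v ∈ special S₀ δ U ↔ v ∈ cubeSpecial u := by
  refine ⟨fun hv => ?_, fun hv => hU (Set.mem_image_of_mem f hv)⟩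
  obtain ⟨i, hi⟩ := exists_le_hammingDist_cubeFlip (by omega : 0 < m) u.1 v.1
  have hpar := even_hammingDist_add u.1 v.1
  have hpar' := even_hammingDist_add (u.flip i).1 v.1
  have hu := u.2
  have hv' := v.2
  have hui := (u.flip i).2
  have hd : hammingDist (u.flip i).1 v.1 ≤ 2 := by
    rcases hQ.eq_or_adj_of_adj (mem_special.1 (hU (Set.mem_image_of_mem f (u.flip_mem i))))
      (mem_special.1 hv) with h | h
    · rw [f.injective h, hammingDist_self]
      omega
    · have : hammingDist (u.flip i).1 v.1 = 2 := f.map_adj_iff.1 h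
      omega
  have hi' : min (hammingDist u.1 v.1 + 1) (m - 1) ≤ hammingDist (u.flip i).1 v.1 := hi
  change hammingDist v.1 u.1 = 1
  rw [hammingDist_comm]
  simp only [Nat.even_iff, Nat.odd_iff] at *
  omega

/-- Different special subsets are mapped into different special subspaces. -/
theorem IsTypeD.eq_of_image_subset (hQ : Q.IsTypeD n) (hm : 4 ≤ m)
    (f : halfCubeGraph m ↪g halfSpinGraph S₀ δ) {u w : OddVertex m} {U : halfSpin S₀ (!δ)}
    (hu : f '' cubeSpecial u ⊆ special S₀ δ U) (hw : f '' cubeSpecial w ⊆ special S₀ δ U) :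
    u = w := by
  obtain ⟨i, hi⟩ := exists_le_hammingDist_cubeFlip (by omega : 0 < m) u.1 w.1
  have h : hammingDist (cubeFlip u.1 i) w.1 = 1 := (hQ.mem_special_iff hm f hw (u.flip i)).1
    (hu (Set.mem_image_of_mem f (u.flip_mem i)))
  refine Subtype.ext (hammingDist_eq_zero.1 ?_)
  omega

/-- Sending each odd vertex `u` to the subspace `U u` extends `f` to the hypercube. -/
theorem IsTypeD.exists_extension (hQ : Q.IsTypeD n) (hm : 4 ≤ m)
    (f : halfCubeGraph m ↪g halfSpinGraph S₀ δ) {U : OddVertex m → halfSpin S₀ (!δ)}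
    (hU : ∀ u, f '' cubeSpecial u ⊆ special S₀ δ (U u)) : Extendible f := by
  classical
  let g : (Fin m → Bool) → Q.MaxGr n := fun v =>
    if h : Even (cubeWeight v) then (f ⟨v, h⟩).1 else (U ⟨v, Nat.not_even_iff_odd.1 h⟩).1
  have hge : ∀ v : EvenVertex m, g v.1 = (f v).1 := fun v => dif_pos v.2
  have hgo : ∀ u : OddVertex m, g u.1 = (U u).1 := fun u => dif_neg (Nat.not_even_iff_odd.2 u.2)
  have hmem : ∀ v, g v ∈ halfSpin S₀ δ ↔ Even (cubeWeight v) := by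
    intro v
    by_cases h : Even (cubeWeight v)
    · rw [hge ⟨v, h⟩]
      exact iff_of_true (f ⟨v, h⟩).2 h
    · rw [hgo ⟨v, Nat.not_even_iff_odd.1 h⟩]
      exact iff_of_false (hQ.not_mem_halfSpin.1 (U _).2) h
  have hinj : Function.Injective g := by
    intro v w hvw
    have h : Even (cubeWeight v) ↔ Even (cubeWeight w) := by rw [← hmem v, ← hmem w, hvw]
    by_cases hv : Even (cubeWeight v)
    · have hw := h.1 hv
      rw [hge ⟨v, hv⟩, hge ⟨w, hw⟩] at hvw
      exact congrArg Subtype.val (f.injective (Subtype.ext hvw))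
    · have hw : ¬ Even (cubeWeight w) := fun hw => hv (h.2 hw)
      rw [Nat.not_even_iff_odd] at hv hw
      rw [hgo ⟨v, hv⟩, hgo ⟨w, hw⟩] at hvw
      have hUvw : U ⟨v, hv⟩ = U ⟨w, hw⟩ := Subtype.ext hvw
      exact congrArg Subtype.val (hQ.eq_of_image_subset hm f (u := ⟨v, hv⟩) (w := ⟨w, hw⟩) (hU _)
        (hUvw ▸ hU _))
  have hadj : ∀ (v : EvenVertex m) (u : OddVertex m),
      (Q.dualPolarGraph n).Adj (g v.1) (g u.1) ↔ (hypercubeGraph m).Adj v.1 u.1 := by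
    intro v u
    rw [hge, hgo, ← mem_special]
    exact hQ.mem_special_iff hm f (hU u) v
  have hpar : ∀ {v w}, (Q.dualPolarGraph n).Adj (g v) (g w) →
      (Even (cubeWeight v) ↔ ¬ Even (cubeWeight w)) := by
    intro v w h
    rw [← hmem v, ← hmem w]
    exact ⟨fun hv => hQ.not_mem_halfSpin.1 (hQ.mem_halfSpin_of_adj hv h), fun hw => by
      simpa using hQ.mem_halfSpin_of_adj (hQ.not_mem_halfSpin.2 hw) h.symm⟩
  have hpar' : ∀ {v w}, (hypercubeGraph m).Adj v w →
      (Even (cubeWeight v) ↔ ¬ Even (cubeWeight w)) := by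
    intro v w h
    have h1 := even_hammingDist_add v w
    have h2 : hammingDist v w = 1 := h
    simp only [Nat.even_iff] at *
    omega
  refine ⟨⟨⟨g, hinj⟩, ?_⟩, hge⟩
  intro v w
  change (Q.dualPolarGraph n).Adj (g v) (g w) ↔ _
  by_cases hv : Even (cubeWeight v) <;> by_cases hw : Even (cubeWeight w)
  · exact iff_of_false (fun h => (hpar h).1 hv hw) fun h => (hpar' h).1 hv hw
  · exact hadj ⟨v, hv⟩ ⟨w, Nat.not_even_iff_odd.1 hw⟩
  · rw [SimpleGraph.adj_comm, (hypercubeGraph m).adj_comm]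
    exact hadj ⟨w, hw⟩ ⟨v, Nat.not_even_iff_odd.1 hv⟩
  · exact iff_of_false (fun h => hv ((hpar h).2 hw)) fun h => hv ((hpar' h).2 hw)

theorem IsTypeD.exists_special_of_isExtension (hQ : Q.IsTypeD n) (hm : 0 < m)
    {f : halfCubeGraph m ↪g halfSpinGraph S₀ δ} {g : hypercubeGraph m ↪g Q.dualPolarGraph n}
    (hg : IsExtension f g) (u : OddVertex m) :
    ∃ U : halfSpin S₀ (!δ), g u.1 = U.1 ∧ f '' cubeSpecial u ⊆ special S₀ δ U := by
  have hadj : ∀ v ∈ cubeSpecial u, (Q.dualPolarGraph n).Adj (f v).1 (g u.1) := fun v hv =>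
    hg v ▸ g.map_adj_iff.2 hv
  refine ⟨⟨g u.1, hQ.mem_halfSpin_of_adj (f (u.flip ⟨0, hm⟩)).2 (hadj _ (u.flip_mem _))⟩, rfl, ?_⟩
  rintro _ ⟨v, hv, rfl⟩
  exact mem_special.2 (hadj v hv)

theorem rk_le_rk_inter_of_adj {S U : Q.MaxGr n} (h : (Q.dualPolarGraph n).Adj S U) {A : Set P}
    (hA : Q.IsSubspace A) (hAS : A ⊆ S.1) : Q.rk A ≤ Q.rk (A ∩ U.1) + 1 := by
  have h1 := rk_add_rk_le S.2.1 hA (S.isSingular_inter U).1 hAS Set.inter_subset_left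
  rw [← Set.inter_assoc, Set.inter_eq_left.2 hAS, S.rk_eq] at h1
  have h2 := dualPolarGraph_adj.1 h
  omega

/-- An embedding of the hypercube maps stars of the half-cube into stars: for an even vertex `v`
the subspaces given by `v` and by its neighbours in three directions share a subspace of
codimension three, which lies in the subspaces of all four vertices. -/
theorem IsTypeD.exists_star (hQ : Q.IsTypeD n) (hn : 4 ≤ n)
    {f : halfCubeGraph m ↪g halfSpinGraph S₀ δ} {g : hypercubeGraph m ↪g Q.dualPolarGraph n}
    (hg : IsExtension f g) {T : Finset (Fin m)} (hT : T.card = 3) (x : Fin m → Bool) :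
    ∃ M : Q.Grassmannian ((n : ℤ) - 4), f '' cubeStar T x ⊆ star S₀ δ M := by
  obtain ⟨i, j, k, -, -, -, hTeq⟩ := Finset.card_eq_three.1 hT
  obtain ⟨v, hv⟩ : ∃ v : EvenVertex m, v ∈ cubeStar T x := by
    by_cases h : Even (cubeWeight x)
    · exact ⟨⟨x, h⟩, fun _ _ => rfl⟩
    · refine ⟨⟨cubeFlip x i, (even_cubeWeight_cubeFlip x i).2 (Nat.not_even_iff_odd.1 h)⟩, ?_⟩
      intro l hl
      refine cubeFlip_of_ne x ?_
      rintro rfl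
      simp [hTeq] at hl
  set S := (f v).1
  let U : Fin m → Q.MaxGr n := fun l => g (cubeFlip v.1 l)
  have hadj : ∀ l, (Q.dualPolarGraph n).Adj S (U l) := fun l => by
    have h := g.map_adj_iff.2 (hypercubeGraph_adj_cubeFlip v.1 l).symm
    rwa [hg v] at h
  have h1 := dualPolarGraph_adj.1 (hadj i)
  have hA := S.isSingular_inter (U i)
  have hB := hA.inter (U j).2.1.1
  have hC := hB.inter (U k).2.1.1
  have h2 := rk_le_rk_inter_of_adj (hadj j) hA.1 Set.inter_subset_left
  have h3 := rk_le_rk_inter_of_adj (hadj k) hB.1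
    (Set.inter_subset_left.trans Set.inter_subset_left)
  obtain ⟨M, hMsub, hM, hMr⟩ := exists_subset_rk_eq hC (k := n - 3) (by omega)
  have hMS : M ⊆ S.1 := fun y hy => (hMsub hy).1.1.1
  have hMU : ∀ l ∈ T, M ⊆ (U l).1 := by
    intro l hl y hy
    rw [hTeq] at hl
    simp only [Finset.mem_insert, Finset.mem_singleton] at hl
    rcases hl with rfl | rfl | rfl
    · exact (hMsub hy).1.1.2
    · exact (hMsub hy).1.2
    · exact (hMsub hy).2
  refine ⟨⟨M, hM, (hasDim_iff hM).2 (by omega)⟩, ?_⟩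
  rintro _ ⟨w, hw, rfl⟩
  change M ⊆ (f w).1.1
  have hwT : ∀ l, w.1 l ≠ v.1 l → l ∈ T := fun l hl =>
    not_not.1 fun h => hl ((hw l h).trans (hv l h).symm)
  have hd : hammingDist w.1 v.1 ≤ 3 := hT ▸ Finset.card_le_card fun l hl =>
    hwT l (Finset.mem_filter.1 hl).2
  have hpar := even_hammingDist_add w.1 v.1
  have hpv := v.2
  have hpw := w.2
  obtain h0 | hd2 : hammingDist w.1 v.1 = 0 ∨ hammingDist w.1 v.1 = 2 := by
    simp only [Nat.even_iff] at *
    omega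
  · rw [Subtype.ext (hammingDist_eq_zero.1 h0)]
    exact hMS
  obtain ⟨a, b, hab, ha, hb, hwab⟩ := exists_eq_cubeFlip_cubeFlip hd2
  have hwa : (Q.dualPolarGraph n).Adj (f w).1 (U a) := by
    rw [← hg w, hwab]
    exact g.map_adj_iff.2 (hypercubeGraph_adj_cubeFlip _ b)
  have hwb : (Q.dualPolarGraph n).Adj (f w).1 (U b) := by
    rw [← hg w, hwab, cubeFlip_comm]
    exact g.map_adj_iff.2 (hypercubeGraph_adj_cubeFlip _ a)
  have hUab : U a ≠ U b := by
    intro h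
    have := congrFun (g.injective h) a
    simp [cubeFlip_of_ne v.1 hab] at this
  have hfadj : (halfSpinGraph S₀ δ).Adj (f v) (f w) :=
    (f.map_adj_iff.2 hd2 : (halfSpinGraph S₀ δ).Adj (f w) (f v)).symm
  have hinter := hQ.inter_eq_of_adj (hadj a) (hadj b) hwa hwb hUab (halfSpinGraph_adj.1 hfadj)
  intro y hy
  exact (hinter ▸ ⟨⟨hMS hy, hMU a (hwT a ha) hy⟩, hMU b (hwT b hb) hy⟩ :
    y ∈ S.1 ∩ (f w).1.1).2

end PolarSpace

theorem proposition4p2 {P : Type*} (Q : PolarSpace P) (n m : ℕ) (hn : 4 ≤ n) (hm : 4 ≤ m)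
    (hQ : Q.IsTypeD n) (S₀ : Q.MaxGr n) (δ : Bool)
    (f : halfCubeGraph m ↪g PolarSpace.halfSpinGraph S₀ δ) :
    (PolarSpace.Extendible f ↔ PolarSpace.ConditionA f) ∧
    (PolarSpace.ConditionA f →
      (∃! g : hypercubeGraph m ↪g Q.dualPolarGraph n, PolarSpace.IsExtension f g) ∧
      ∀ g : hypercubeGraph m ↪g Q.dualPolarGraph n, PolarSpace.IsExtension f g →
        ∀ u : OddVertex m, ∃ U : PolarSpace.halfSpin S₀ (!δ),
          g u.1 = U.1 ∧
          f '' cubeSpecial u ⊆ PolarSpace.special S₀ δ U ∧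
          ∀ U' : PolarSpace.halfSpin S₀ (!δ),
            f '' cubeSpecial u ⊆ PolarSpace.special S₀ δ U' → U' = U) := by
  have hext : PolarSpace.ConditionA f → PolarSpace.Extendible f := by
    rintro ⟨-, h⟩
    choose U hU using h
    exact hQ.exists_extension hm f hU
  refine ⟨⟨?_, hext⟩, fun hA => ⟨?_, fun g hg u => ?_⟩⟩
  · rintro ⟨g, hg⟩
    refine ⟨fun T x hT => hQ.exists_star hn hg hT x, fun u => ?_⟩
    obtain ⟨U, -, hU⟩ := hQ.exists_special_of_isExtension (by omega) hg u
    exact ⟨U, hU⟩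
  · obtain ⟨g, hg⟩ := hext hA
    refine ⟨g, hg, fun g' hg' => DFunLike.ext _ _ fun v => ?_⟩
    by_cases hv : Even (cubeWeight v)
    · exact (hg' ⟨v, hv⟩).trans (hg ⟨v, hv⟩).symm
    · rw [Nat.not_even_iff_odd] at hv
      obtain ⟨U, hgU, hU⟩ := hQ.exists_special_of_isExtension (by omega) hg ⟨v, hv⟩
      obtain ⟨U', hgU', hU'⟩ := hQ.exists_special_of_isExtension (by omega) hg' ⟨v, hv⟩
      exact hgU'.trans ((congrArg Subtype.val (hQ.special_unique hm f _ hU' hU)).trans hgU.symm)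
  · obtain ⟨U, hgU, hU⟩ := hQ.exists_special_of_isExtension (by omega) hg u
    exact ⟨U, hgU, hU, fun U' hU' => hQ.special_unique hm f u hU' hU⟩
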